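/- Fix an integer $L\ge 2$. A \emph{standard RCRS input} consists of a set $M$ of items, a finite set $N$ of products, for each product $j\in N$ a bundle $A_j\subseteq M$ with $1\le |A_j|\le L$, and a vector $(x_j)_{j\in N}\in[0,1]^N$ with $\sum_{j:\,i\in A_j}x_j\le 1$ for every item $i\in M$. Each product $j$ has an arrival time $Y_j$ uniform on $[0,1]$ and is \emph{active} ($X_j=1$) with probability $x_j$; all these random variables are mutually independent. The products are presented in increasing order of arrival time. When $j$ arrives, the scheme sees whether it is active and irrevocably accepts or rejects it; only an active product may be accepted, and only if no previously accepted product shares an item with it. Item $i$ is \emph{available at time $y$} (event $F_i(y)$) if it belongs to no product accepted before time $y$. A scheme is \emph{$\alpha$-selectable} if on every input it satisfies these requirements almost surely and accepts every product $j$ with probability at least $\alpha x_j$. A \emph{selection function} is a (weakly) decreasing function $c:[0,1]\to[0,1]$ with $c(1)>0$ such that for all $y\in[0,1]$ $$c(y)\le 1-L\int_0^y c(z)\,dz+\frac{L-1}{L}\left(\int_0^y c(z)(1-z)^L\,dz\right)^2 .$$ Given a positive integer $K$ and a selection function $c$, put $y_q=q/K$. The \emph{recursive standard RCRS} runs in phases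 $q=0,\dots,K-1$. At the start of phase $q$ it sets $\hat F_j(0)=1$ for every $j$ if $q=0$, and, if $q\ge1$, $\hat F_j(q)=\mathbb P\bigl(\bigcap_{i\in A_j}F_i(y_q)\mid Y_j>y_q\bigr)$ for every $j$, computed from the scheme already defined up to time $y_q$. A product $j$ arriving at time $Y_j=y\in(y_q,y_{q+1}]$ draws an independent random bit $B_j$ with $\mathbb P(B_j=1)=\min\{c(y)/\hat F_j(q),1\}$, and is accepted if and only if $B_jX_j=1$ and all items of $A_j$ are available at time $y$. \textbf{Theorem.} Let $c$ be a selection function and let $K\ge 2L/c(1)$ be an integer. Then the recursive standard RCRS with parameters $K$ and $c$ is $\left(1-\frac{L}{K\,c(1)}\right)\int_0^1 c(y)\,dy$-selectable. -/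

import Mathlib

open MeasureTheory ProbabilityTheory
open scoped unitInterval

namespace RCRS

/-- A selection function `c : [0,1] → [0,1]` for `L`-bounded products. Integrals are with respect
to Lebesgue measure on `[0,1]`. -/
structure IsSelectionFunction (L : ℕ) (c : I → I) : Prop where
  antitone : Antitone c
  one_pos : 0 < (c 1 : ℝ)
  le_rhs : ∀ y : I, (c y : ℝ) ≤ 1 - L * (∫ z in Set.Iic y, (c z : ℝ))
    + ((L : ℝ) - 1) / L * (∫ z in Set.Iic y, (c z : ℝ) * (1 - (z : ℝ)) ^ L) ^ 2

/-- A standard input with `L`-bounded products: product `j` requires the bundle `A j` of between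
`1` and `L` items, it is active with probability `x j`, and no item is sold more than once in
expectation. -/
structure IsInput {M N : Type*} [DecidableEq M] [Fintype N]
    (L : ℕ) (A : N → Finset M) (x : N → I) : Prop where
  one_le_card : ∀ j, 1 ≤ (A j).card
  card_le : ∀ j, (A j).card ≤ L
  feasible : ∀ i : M, ∑ j with i ∈ A j, (x j : ℝ) ≤ 1

/-- An outcome of all the randomness: for each product an arrival time, an activity indicator, and
a seed from which the random bit of the product is drawn. -/
abbrev Outcome (N : Type*) : Type _ := N → I × Bool × I

/-- The arrival time `Y j`. -/
def arrival {N : Type*} (ω : Outcome N) (j : N) : I := (ω j).1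

/-- The event `X j = 1`. -/
def Active {N : Type*} (ω : Outcome N) (j : N) : Prop := (ω j).2.1 = true

/-- The seed of the product `j`. -/
def seed {N : Type*} (ω : Outcome N) (j : N) : I := (ω j).2.2

/-- The joint law of the randomness: everything is independent, arrival times and seeds are
uniform on `[0,1]`, and product `j` is active with probability `x j`. -/
noncomputable def law {N : Type*} [Fintype N] (x : N → I) : Measure (Outcome N) :=
  Measure.pi fun j => (volume : Measure I).prod ((bernoulliMeasure true false (x j)).prod volume)

/-- With arrival times `y`, and with `s j` saying that product `j` is active and that its random
bit is `1`: product `j` is accepted if and only if `s j` holds and no item of `j` belongs to a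
product that was accepted before time `y j`. -/
def Accepts {M N : Type*} [Finite N] (A : N → Finset M) (y : N → I) (s : N → Prop) (j : N) :
    Prop :=
  s j ∧ ∀ i ∈ A j, ∀ j' : N, y j' < y j → Accepts A y s j' → i ∉ A j'
termination_by {j' : N | y j' < y j}.ncard
decreasing_by
  rename_i h
  exact Set.ncard_lt_ncard
    ⟨fun _ hk => lt_trans hk h, fun hs => lt_irrefl (y _) (hs h)⟩ (Set.toFinite _)

/-- Item `i` is available at time `t`: it is in no product accepted before time `t`. -/
def Available {M N : Type*} [Finite N] (A : N → Finset M) (y : N → I) (s : N → Prop)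
    (i : M) (t : ℝ) : Prop :=
  ∀ j : N, (y j : ℝ) < t → Accepts A y s j → i ∉ A j

theorem accepts_iff {M N : Type*} [Finite N] (A : N → Finset M) (y : N → I) (s : N → Prop)
    (j : N) : Accepts A y s j ↔ s j ∧ ∀ i ∈ A j, Available A y s i (y j) := by
  unfold Available
  rw [Accepts]
  simp only [Subtype.coe_lt_coe]

/-- The phase of an arrival time: `phase K y = q` for `y ∈ (q / K, (q + 1) / K]`, and the null
case `y = 0` is put into phase `0`. -/
noncomputable def phase (K : ℕ) (y : I) : ℕ := ⌈(K : ℝ) * y⌉₊ - 1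

/-- Product `j` is active and its random bit is `1`, where `F q j` is the number used in phase `q`.
Given that `j` arrives at time `y` in phase `q`, the bit is `1` with probability
`min (c y / F q j) 1`. -/
def Survives {N : Type*} (c : I → I) (K : ℕ) (F : ℕ → N → ℝ) (ω : Outcome N) (j : N) : Prop :=
  Active ω j ∧
    (seed ω j : ℝ) ≤ min ((c (arrival ω j) : ℝ) / F (phase K (arrival ω j)) j) 1

/-- The numbers computed at the start of phase `q`: `feasProb A x c K 0 j = 1`, and for `q ≥ 1`
it is the probability, conditional on `j` arriving after time `q / K`, that all items of `j` are
available at time `q / K`. The run up to time `q / K` uses only the numbers of the phases `r < q`;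
the value `1` below for other `r` is never used. -/
noncomputable def feasProb {M N : Type*} [Fintype N] (A : N → Finset M) (x : N → I) (c : I → I)
    (K : ℕ) : ℕ → N → ℝ
  | 0 => fun _ => 1
  | q + 1 => fun j =>
      (cond (law x) {ω | ((q + 1 : ℕ) : ℝ) / K < arrival ω j}).real
        {ω | ∀ i ∈ A j, Available A (arrival ω)
          (Survives c K (fun r => if _h : r < q + 1 then feasProb A x c K r else fun _ => 1) ω)
          i (((q + 1 : ℕ) : ℝ) / K)}

/-- The recursive standard RCRS with `K` phases accepts product `j`. -/
def RecursiveRCRS {M N : Type*} [Fintype N] (A : N → Finset M) (x : N → I) (c : I → I) (K : ℕ)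
    (ω : Outcome N) (j : N) : Prop :=
  Accepts A (arrival ω) (Survives c K (feasProb A x c K) ω) j

/-- The scheme that accepts `j` on the event `acc · j` is `α`-selectable on the given input: almost
surely it accepts only active products and the accepted products are pairwise disjoint, and every
product `j` is accepted with probability at least `α * x j`. -/
structure IsSelectableOn {M N : Type*} [Fintype N] (A : N → Finset M) (x : N → I)
    (acc : Outcome N → N → Prop) (α : ℝ) : Prop where
  active : ∀ᵐ ω ∂law x, ∀ j, acc ω j → Active ω j
  disjoint : ∀ᵐ ω ∂law x, ∀ j j', j ≠ j' → acc ω j → acc ω j' → Disjoint (A j) (A j')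
  measurable : ∀ j, MeasurableSet {ω | acc ω j}
  le_prob : ∀ j, α * x j ≤ (law x).real {ω | acc ω j}

end RCRS

/-! Delete `k` from the run and let `freeProb k t` be the probability that its items are then
available at time `t`. The deleted run is independent of the randomness of `k`, and `k` has no
influence before it is accepted. Hence `k` is accepted at time `z` with density `x k * bitProb k z *
freeProb k z` (`law_real_accepts`), and the number computed for phase `q` is `freeProb k (q / K)`
(`feasProb_eq_freeProb`).

Suppose each such number `f` is at least `c z` for every `z` in its phase (`le_feasProb`). Then the
bit has probability exactly `c z / f`. Within a phase `freeProb` drops by at most `L / K`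
(`freeProb_sub_le`), which is at most the fraction `L / (K * c 1)` of `f` because `f ≥ c 1`.
Integrating over `z` gives the theorem.

The bound on `f` is proved by induction on phases. If it holds in earlier phases, then up to `t = q
/ K` acceptance rates are at most `c` and bit probabilities at least `c`. Let `B` be the number of
neighbors of `k` accepted before `t`. Accepted products are disjoint, so `B ≤ L`, and the indicator
of `k` being free is at least `1 - B + B (B - 1) / L` (`indicator_free_ge`). In expectation the
linear term costs at most `C = ∫ c` per unit of neighbor mass. Two disjoint neighbors `l`, `l'` are
both accepted with probability at least `x l * x l' * D ^ 2`, where `D = ∫ c (1 - z) ^ L`, because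
with enough probability nothing that conflicts with them is active before them
(`law_real_accepts_pair_ge`). Counting disjoint pairs (`sum_disjoint_pairs_ge`) and optimizing over
the neighbor masses (`mass_bound`) leaves exactly the right-hand side of the selection inequality.
-/

namespace RCRS

/-! ### Deterministic greedy acceptance: comparison of runs and measurability -/

/-- Two runs that agree on the products that are accepted in the first or survive in the second
before time `t` accept the same products before time `t`. -/
theorem accepts_congr {M N : Type*} [Finite N] {A : N → Finset M} {y y' : N → I}
    {s s' : N → Prop} {t : ℝ}
    (h : ∀ l, (y l : ℝ) < t → Accepts A y s l → y' l = y l ∧ s' l)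
    (h' : ∀ l, (y' l : ℝ) < t → s' l → y l = y' l ∧ s l) (l : N) :
    ((y l : ℝ) < t ∧ Accepts A y s l) ↔ ((y' l : ℝ) < t ∧ Accepts A y' s' l) := by
  have wf : WellFounded (fun a b : N => y a < y b) := by
    have : IsTrans N (fun a b : N => y a < y b) := ⟨fun _ _ _ => lt_trans⟩
    have : Std.Irrefl (fun a b : N => y a < y b) := ⟨fun a => lt_irrefl (y a)⟩
    exact Finite.wellFounded_of_trans_of_irrefl _
  induction l using wf.induction with
  | _ l ih =>
  constructor
  · rintro ⟨hl, ha⟩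
    obtain ⟨h1, h2⟩ := h l hl ha
    refine ⟨by rw [h1]; exact hl, ?_⟩
    rw [accepts_iff]
    refine ⟨h2, fun i hi l' hl' hacc => ?_⟩
    have hlt : (y' l' : ℝ) < t := hl'.trans (by rw [h1]; exact hl)
    obtain ⟨h3, _⟩ := h' l' hlt ((accepts_iff _ _ _ _).1 hacc).1
    have h4 : y l' < y l := by rw [h3, ← h1]; exact hl'
    exact ((accepts_iff _ _ _ _).1 ha).2 i hi l' h4 ((ih l' h4).2 ⟨hlt, hacc⟩).2
  · rintro ⟨hl, ha⟩
    obtain ⟨h1, h2⟩ := h' l hl ((accepts_iff _ _ _ _).1 ha).1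
    refine ⟨by rw [h1]; exact hl, ?_⟩
    rw [accepts_iff]
    refine ⟨h2, fun i hi l' hl' hacc => ?_⟩
    have hlt : (y l' : ℝ) < t := hl'.trans (by rw [h1]; exact hl)
    obtain ⟨h3, h4⟩ := (ih l' hl').1 ⟨hlt, hacc⟩
    have h5 := (h l' hlt hacc).1
    exact ((accepts_iff _ _ _ _).1 ha).2 i hi l' (by rw [h5, ← h1]; exact hl') h4

theorem available_congr {M N : Type*} [Finite N] {A : N → Finset M} {y y' : N → I}
    {s s' : N → Prop} {t : ℝ}
    (h : ∀ l, (y l : ℝ) < t → Accepts A y s l → y' l = y l ∧ s' l)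
    (h' : ∀ l, (y' l : ℝ) < t → s' l → y l = y' l ∧ s l) (i : M) :
    Available A y s i t ↔ Available A y' s' i t := by
  constructor
  · intro ha l h1 h2
    have := (accepts_congr h h' l).2 ⟨h1, h2⟩
    exact ha l this.1 this.2
  · intro ha l h1 h2
    have := (accepts_congr h h' l).1 ⟨h1, h2⟩
    exact ha l this.1 this.2

/-- Which products are accepted depends on the arrival times only through their order. -/
theorem accepts_iff_of_order_iff {M N : Type*} [Finite N] {A : N → Finset M} {y y' : N → I}
    {s s' : N → Prop} (h : ∀ a b, y a < y b ↔ y' a < y' b) (hs : ∀ a, s a ↔ s' a) (l : N) :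
    Accepts A y s l ↔ Accepts A y' s' l := by
  have wf : WellFounded (fun a b : N => y a < y b) := by
    have : IsTrans N (fun a b : N => y a < y b) := ⟨fun _ _ _ => lt_trans⟩
    have : Std.Irrefl (fun a b : N => y a < y b) := ⟨fun a => lt_irrefl (y a)⟩
    exact Finite.wellFounded_of_trans_of_irrefl _
  induction l using wf.induction with
  | _ l ih =>
  rw [Accepts, Accepts, hs l]
  refine and_congr Iff.rfl (forall₂_congr fun i _ => forall_congr' fun l' => ?_)
  rw [← h]
  exact forall_congr' fun hl => imp_congr_left (ih l' hl)

/-- Acceptance is a function of the order pattern of the arrival times and of the truth values of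
`s`, which together take finitely many values. -/
theorem measurableSet_accepts {M N Ω : Type*} [Finite N] [MeasurableSpace Ω] (A : N → Finset M)
    {y : Ω → N → I} {s : Ω → N → Prop} (hy : ∀ a, Measurable fun ω => y ω a)
    (hs : ∀ a, MeasurableSet {ω | s ω a}) (l : N) :
    MeasurableSet {ω | Accepts A (y ω) (s ω) l} := by
  classical
  let f : Ω → (N × N → Prop) × (N → Prop) :=
    fun ω => (fun p => y ω p.1 < y ω p.2, fun a => s ω a)
  have hf : Measurable f := by
    refine Measurable.prodMk (measurable_pi_lambda _ fun p => ?_) (measurable_pi_lambda _ fun a => ?_)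
    · exact measurableSet_setOfPred.1 (measurableSet_lt (hy p.1) (hy p.2))
    · exact measurableSet_setOfPred.1 (hs a)
  have : {ω | Accepts A (y ω) (s ω) l} = f ⁻¹' (f '' {ω | Accepts A (y ω) (s ω) l}) := by
    refine Set.Subset.antisymm (Set.subset_preimage_image _ _) ?_
    rintro ω ⟨ω', h1, h2⟩
    refine (accepts_iff_of_order_iff (fun a b => ?_) (fun a => ?_) l).1 h1
    · exact iff_of_eq (congrFun (congrArg Prod.fst h2) (a, b))
    · exact iff_of_eq (congrFun (congrArg Prod.snd h2) a)
  rw [this]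
  exact hf (Set.toFinite _).measurableSet

theorem measurableSet_available {M N Ω : Type*} [Finite N] [MeasurableSpace Ω] (A : N → Finset M)
    {y : Ω → N → I} {s : Ω → N → Prop} (hy : ∀ a, Measurable fun ω => y ω a)
    (hs : ∀ a, MeasurableSet {ω | s ω a}) (i : M) (t : ℝ) :
    MeasurableSet {ω | Available A (y ω) (s ω) i t} := by
  have : {ω | Available A (y ω) (s ω) i t} =
      ⋂ l : N, ({ω | (y ω l : ℝ) < t} ∩ {ω | Accepts A (y ω) (s ω) l} ∩ {_ω | i ∈ A l})ᶜ := by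
    ext ω
    simp [Available]
  rw [this]
  refine MeasurableSet.iInter fun l => MeasurableSet.compl (MeasurableSet.inter
    (MeasurableSet.inter ?_ (measurableSet_accepts A hy hs l)) (MeasurableSet.const _))
  exact measurableSet_lt (measurable_subtype_coe.comp (hy l)) measurable_const

/-! ### The product law and resampling of one product -/

section Law

theorem measurable_update_prod {N : Type*} [DecidableEq N] (k : N) :
    Measurable fun p : Outcome N × (I × Bool × I) => Function.update p.1 k p.2 := by
  refine measurable_pi_lambda _ fun l => ?_
  by_cases h : l = k
  · subst h; simpa using measurable_snd
  · simp only [Function.update_of_ne h]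
    exact (measurable_pi_apply l).comp measurable_fst

/-- The law of the randomness of a single product. -/
noncomputable def productLaw (p : I) : Measure (I × Bool × I) :=
  (volume : Measure I).prod ((bernoulliMeasure true false p).prod volume)

instance (p : I) : IsProbabilityMeasure (productLaw p) := by
  unfold productLaw; infer_instance

variable {N : Type*} [Fintype N]

theorem law_eq_pi (x : N → I) : law x = Measure.pi fun j => productLaw (x j) := rfl

instance (x : N → I) : IsProbabilityMeasure (law x) := by
  rw [law_eq_pi]; infer_instance

/-- The randomness of a single product may be drawn afresh. -/
theorem law_apply_update [DecidableEq N] (x : N → I) (k : N) {S : Set (Outcome N)}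
    (hS : MeasurableSet S) :
    law x S = ∫⁻ u, law x {ω | Function.update ω k u ∈ S} ∂productLaw (x k) := by
  have hupd := measurable_update_prod k
  have hf : Measurable (S.indicator (1 : Outcome N → ENNReal)) := measurable_one.indicator hS
  have hg : Measurable fun ω : Outcome N => ∫⁻ u, S.indicator (1 : Outcome N → ENNReal)
      (Function.update ω k u) ∂productLaw (x k) :=
    (hf.comp hupd).lintegral_prod_right'
  have key : ∫⁻ ω, S.indicator (1 : Outcome N → ENNReal) ω ∂law x = ∫⁻ ω, ∫⁻ u,
      S.indicator (1 : Outcome N → ENNReal) (Function.update ω k u) ∂productLaw (x k) ∂law x := by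
    rw [law_eq_pi]
    refine lintegral_eq_of_lmarginal_eq {k} hf hg ?_
    rw [lmarginal_singleton, lmarginal_singleton]
    ext ω
    simp
  rw [lintegral_indicator_one hS] at key
  rw [key, lintegral_lintegral_swap]
  · refine lintegral_congr fun u => ?_
    have hm : MeasurableSet {ω | Function.update ω k u ∈ S} :=
      (hupd.comp measurable_prodMk_right) hS
    rw [← lintegral_indicator_one hm]
    rfl
  · exact (hf.comp hupd).aemeasurable

theorem measurable_law_update [DecidableEq N] (x : N → I) (k : N) {S : Set (Outcome N)}
    (hS : MeasurableSet S) :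
    Measurable fun u => (law x).real {ω | Function.update ω k u ∈ S} :=
  (measurable_measure_prodMk_right (measurable_update_prod k hS)).ennreal_toReal

theorem law_real_update [DecidableEq N] (x : N → I) (k : N) {S : Set (Outcome N)}
    (hS : MeasurableSet S) :
    (law x).real S = ∫ u, (law x).real {ω | Function.update ω k u ∈ S} ∂productLaw (x k) := by
  simp only [Measure.real]
  rw [integral_toReal, ← law_apply_update x k hS]
  · exact (measurable_measure_prodMk_right (measurable_update_prod k hS)).aemeasurable
  · exact ae_of_all _ fun _ => measure_lt_top _ _

/-- For a product arriving at `z`, integrating out the activity and the seed contributes the factors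
`p` and `v z`. It is applied with `v` the bit probability, and with `v = c` for lower bounds. -/
theorem integral_productLaw (p : I) {v g : I → ℝ} (hv : Measurable v) (hg : Measurable g)
    (hv0 : ∀ z, 0 ≤ v z) (hv1 : ∀ z, v z ≤ 1) (hg0 : ∀ z, 0 ≤ g z) (hg1 : ∀ z, g z ≤ 1) :
    ∫ u, {u : I × Bool × I | u.2.1 = true ∧ (u.2.2 : ℝ) ≤ v u.1}.indicator (fun u => g u.1) u
      ∂productLaw p = p * ∫ z, v z * g z := by
  have hS : MeasurableSet {u : I × Bool × I | u.2.1 = true ∧ (u.2.2 : ℝ) ≤ v u.1} := by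
    refine MeasurableSet.inter ?_ ?_
    · exact (measurable_fst.comp measurable_snd) (measurableSet_singleton true)
    · exact measurableSet_le (measurable_subtype_coe.comp (measurable_snd.comp measurable_snd))
        (hv.comp measurable_fst)
  unfold productLaw
  rw [integral_prod]
  · rw [← integral_const_mul]
    refine integral_congr_ae (ae_of_all _ fun z => ?_)
    have : (fun w : Bool × I => {u : I × Bool × I | u.2.1 = true ∧ (u.2.2 : ℝ) ≤ v u.1}.indicator
        (fun u => g u.1) (z, w)) =
        ({true} ×ˢ Set.Iic (⟨v z, hv0 z, hv1 z⟩ : I)).indicator fun _ => g z := by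
      ext ⟨b, w⟩
      simp only [Set.indicator, Set.mem_ofPred_eq, Set.mem_prod, Set.mem_singleton_iff, Set.mem_Iic,
        ← Subtype.coe_le_coe]
    simp only [this]
    rw [integral_indicator_const _ ((measurableSet_singleton _).prod measurableSet_Iic),
      measureReal_prod_prod, bernoulliMeasure_real_apply_of_mem_of_notMem _
        (measurableSet_singleton _) (by simp) (by simp), Measure.real, unitInterval.volume_Iic,
      ENNReal.toReal_ofReal (hv0 z), smul_eq_mul]
    ring
  · refine Integrable.of_bound ((hg.comp measurable_fst).indicator hS).aestronglyMeasurable 1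
      (ae_of_all _ fun u => ?_)
    rw [Set.indicator_apply]
    split_ifs
    · rw [Real.norm_eq_abs, abs_of_nonneg (hg0 _)]; exact hg1 _
    · simp

end Law

/-! ### Availability in the run without a product, and acceptance probabilities -/

section Scheme

theorem productLaw_real_active (p : I) (T : Set I) :
    (productLaw p).real {u | u.2.1 = true ∧ u.1 ∈ T} = p * volume.real T := by
  have : {u : I × Bool × I | u.2.1 = true ∧ u.1 ∈ T} = T ×ˢ ({true} ×ˢ Set.univ) := by
    ext ⟨a, b, d⟩
    simp [and_comm]
  rw [this, productLaw, measureReal_prod_prod, measureReal_prod_prod,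
    bernoulliMeasure_real_apply_of_mem_of_notMem _ (measurableSet_singleton _) (by simp) (by simp)]
  simp [mul_comm]

theorem productLaw_real_arrival (p : I) (T : Set I) :
    (productLaw p).real {u | u.1 ∈ T} = volume.real T := by
  have : {u : I × Bool × I | u.1 ∈ T} = T ×ˢ Set.univ := by
    ext ⟨a, b⟩
    simp
  rw [this, productLaw, measureReal_prod_prod]
  simp

theorem law_real_eval {N : Type*} [Fintype N] (x : N → I) (l : N) {S : Set (I × Bool × I)}
    (hS : MeasurableSet S) : (law x).real {ω | ω l ∈ S} = (productLaw (x l)).real S :=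
  (measurePreserving_eval (fun j => productLaw (x j)) l).measureReal_preimage
    hS.nullMeasurableSet

variable {M N : Type*} [Fintype N] [DecidableEq N] (A : N → Finset M) (x : N → I) (c : I → I)
  (K : ℕ) (F : ℕ → N → ℝ)

/-- The outcome with product `k` made inactive. -/
def without {N : Type*} [DecidableEq N] (k : N) (ω : Outcome N) : Outcome N :=
  Function.update ω k (1, false, 1)

/-- All items of `k` are available at time `t`, when the run uses the numbers `F`. -/
def Free {M N : Type*} [Finite N] (A : N → Finset M) (c : I → I) (K : ℕ) (F : ℕ → N → ℝ)
    (ω : Outcome N) (k : N) (t : ℝ) : Prop :=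
  ∀ i ∈ A k, Available A (arrival ω) (Survives c K F ω) i t

/-- The probability that all items of `k` are available at time `t` in the run without `k`. -/
noncomputable def freeProb (k : N) (t : ℝ) : ℝ :=
  (law x).real {ω | Free A c K F (without k ω) k t}

/-- The probability that the bit of a product `k` arriving at time `z` is `1`. -/
noncomputable def bitProb {N : Type*} (c : I → I) (K : ℕ) (F : ℕ → N → ℝ) (k : N) (z : I) : ℝ :=
  min ((c z : ℝ) / F (phase K z) k) 1

theorem without_of_ne {N : Type*} [DecidableEq N] {k l : N} (h : l ≠ k) (ω : Outcome N) :
    without k ω l = ω l := Function.update_of_ne h _ _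

theorem without_update {N : Type*} [DecidableEq N] (k : N) (ω : Outcome N) (u : I × Bool × I) :
    without k (Function.update ω k u) = without k ω := Function.update_idem _ _ _

theorem not_active_without {N : Type*} [DecidableEq N] (k : N) (ω : Outcome N) :
    ¬ Active (without k ω) k := by
  simp [Active, without]

theorem survives_congr {N : Type*} {c : I → I} {K : ℕ} {F : ℕ → N → ℝ} {ω ω' : Outcome N} {l : N}
    (h : ω l = ω' l) : Survives c K F ω l ↔ Survives c K F ω' l := by
  simp [Survives, Active, arrival, seed, h]

theorem Free.anti {M N : Type*} [Finite N] {A : N → Finset M} {c : I → I} {K : ℕ}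
    {F : ℕ → N → ℝ} {ω : Outcome N} {k : N} {s t : ℝ} (hst : s ≤ t) (h : Free A c K F ω k t) :
    Free A c K F ω k s :=
  fun i hi l hl ha => h i hi l (hl.trans_le hst) ha

-- A product that is not accepted before `t` blocks nothing before `t`, even if it survives. This is
-- why `accepts_congr` asks for agreement only on products accepted in the first run.
variable {A c K F} in
theorem free_iff_free_without {ω : Outcome N} {k : N} {t : ℝ}
    (h : (arrival ω k : ℝ) < t → ¬ Accepts A (arrival ω) (Survives c K F ω) k) :
    Free A c K F ω k t ↔ Free A c K F (without k ω) k t := by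
  refine forall₂_congr fun i _ => available_congr (fun l hl ha => ?_) (fun l hl hs => ?_) i
  · have hne : l ≠ k := fun e => h (e ▸ hl) (e ▸ ha)
    have e := without_of_ne hne ω
    exact ⟨by simp [arrival, e], (survives_congr e).2 ((accepts_iff _ _ _ _).1 ha).1⟩
  · have hne : l ≠ k := fun e => not_active_without k ω (e ▸ hs.1)
    have e := without_of_ne hne ω
    exact ⟨by simp [arrival, e], (survives_congr e).1 hs⟩

-- If `k` had been accepted before `t`, its own items would be unavailable; so freeness already
-- excludes any influence of `k`. Nonemptiness of the bundle is essential here.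
variable {A c K F} in
theorem Free.without {ω : Outcome N} {k : N} {t : ℝ} (hA : (A k).Nonempty)
    (h : Free A c K F ω k t) : Free A c K F (without k ω) k t := by
  refine (free_iff_free_without fun hk ha => ?_).1 h
  obtain ⟨i, hi⟩ := hA
  exact h i hi k hk ha hi

-- No product is accepted strictly before its own arrival, so deleting it does not change the
-- availability that it meets. The second condition thereby depends on `k` only through its arrival
-- time.
variable {A c K F} in
theorem accepts_iff_free_without {ω : Outcome N} {k : N} :
    Accepts A (arrival ω) (Survives c K F ω) k ↔
      Survives c K F ω k ∧ Free A c K F (without k ω) k (arrival ω k) := by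
  rw [accepts_iff, ← free_iff_free_without fun h => (lt_irrefl _ h).elim]
  rfl

theorem phase_le {K : ℕ} {q : ℕ} {y : I} (hK : 0 < K) (h : (y : ℝ) < (q + 1 : ℕ) / K) :
    phase K y ≤ q := by
  have hK' : (0 : ℝ) < K := by exact_mod_cast hK
  rw [lt_div_iff₀ hK'] at h
  have : ⌈(K : ℝ) * y⌉₊ ≤ q + 1 := Nat.ceil_le.2 (by rw [mul_comm]; exact h.le)
  unfold phase
  omega

theorem phase_lt {K : ℕ} (y : I) (hK : 0 < K) : phase K y < K := by
  have : ⌈(K : ℝ) * y⌉₊ ≤ K :=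
    Nat.ceil_le.2 (mul_le_of_le_one_right (Nat.cast_nonneg _) y.2.2)
  unfold phase
  omega

theorem phase_div_le {K : ℕ} (y : I) (hK : 0 < K) : (phase K y : ℝ) / K ≤ y := by
  have hK' : (0 : ℝ) < K := by exact_mod_cast hK
  rw [div_le_iff₀ hK', mul_comm]
  have h0 : (0 : ℝ) ≤ K * y := mul_nonneg hK'.le y.2.1
  unfold phase
  rcases Nat.eq_zero_or_pos ⌈(K : ℝ) * y⌉₊ with h | h
  · rw [h]; simpa using h0
  · rw [Nat.cast_pred h]
    linarith [Nat.ceil_lt_add_one h0]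

theorem sub_phase_div_le {K : ℕ} (y : I) (hK : 0 < K) : (y : ℝ) - phase K y / K ≤ 1 / K := by
  have hK' : (0 : ℝ) < K := by exact_mod_cast hK
  rw [sub_le_iff_le_add, ← add_div, le_div_iff₀ hK', mul_comm]
  refine (Nat.le_ceil _).trans ?_
  have : ⌈(K : ℝ) * y⌉₊ ≤ 1 + phase K y := by unfold phase; omega
  exact_mod_cast this

theorem measurable_phase (K : ℕ) : Measurable (phase K) := by
  unfold phase
  exact (measurable_of_countable fun n : ℕ => n - 1).comp
    (Nat.measurable_ceil.comp (measurable_subtype_coe.const_mul _))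

theorem measurable_bitProb {N : Type*} {c : I → I} (K : ℕ) (F : ℕ → N → ℝ) (hc : Measurable c)
    (k : N) : Measurable (bitProb c K F k) :=
  ((measurable_subtype_coe.comp hc).div
    ((measurable_of_countable fun n => F n k).comp (measurable_phase K))).min measurable_const

theorem measurable_arrival {N : Type*} (k : N) : Measurable fun ω : Outcome N => arrival ω k :=
  measurable_fst.comp (measurable_pi_apply k)

theorem measurableSet_survives {N : Type*} {c : I → I} (K : ℕ) (F : ℕ → N → ℝ)
    (hc : Measurable c) (k : N) :
    MeasurableSet {ω : Outcome N | Survives c K F ω k} := by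
  classical
  refine MeasurableSet.inter ?_ (measurableSet_le ?_
    ((measurable_bitProb K F hc k).comp (measurable_arrival k)))
  · exact (measurable_fst.comp (measurable_snd.comp (measurable_pi_apply k)))
      (measurableSet_singleton true)
  · exact measurable_subtype_coe.comp
      (measurable_snd.comp (measurable_snd.comp (measurable_pi_apply k)))

theorem measurable_without {N : Type*} [DecidableEq N] (k : N) :
    Measurable (without k : Outcome N → Outcome N) :=
  (measurable_update_prod k).comp measurable_prodMk_right

variable {c}

omit [DecidableEq N] in
theorem measurableSet_accepted (hc : Measurable c) (k : N) :
    MeasurableSet {ω | Accepts A (arrival ω) (Survives c K F ω) k} :=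
  measurableSet_accepts A measurable_arrival (measurableSet_survives K F hc) k

omit [DecidableEq N] in
theorem measurableSet_free (hc : Measurable c) (k : N) (t : ℝ) :
    MeasurableSet {ω | Free A c K F ω k t} := by
  have : {ω | Free A c K F ω k t} =
      ⋂ i ∈ A k, {ω | Available A (arrival ω) (Survives c K F ω) i t} := by
    ext; simp [Free]
  rw [this]
  exact Finset.measurableSet_biInter _ fun i _ =>
    measurableSet_available A measurable_arrival (measurableSet_survives K F hc) i t

theorem measurableSet_free_without (hc : Measurable c) (k : N) (t : ℝ) :
    MeasurableSet {ω | Free A c K F (without k ω) k t} :=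
  measurable_without k (measurableSet_free A K F hc k t)

theorem freeProb_nonneg (k : N) (t : ℝ) : 0 ≤ freeProb A x c K F k t := measureReal_nonneg

theorem freeProb_le_one (k : N) (t : ℝ) : freeProb A x c K F k t ≤ 1 := measureReal_le_one

theorem freeProb_antitone (k : N) : Antitone (freeProb A x c K F k) :=
  fun _ _ h => measureReal_mono fun _ => Free.anti h

theorem law_real_free_le_freeProb {k : N} (hA : (A k).Nonempty) (t : ℝ) :
    (law x).real {ω | Free A c K F ω k t} ≤ freeProb A x c K F k t :=
  measureReal_mono fun _ => Free.without hA

theorem freeProb_zero (k : N) : freeProb A x c K F k 0 = 1 := by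
  have : {ω : Outcome N | Free A c K F (without k ω) k 0} = Set.univ := by
    ext ω
    simp only [Set.mem_univ, iff_true]
    exact fun i _ l hl => absurd hl (not_lt.2 (arrival _ l).2.1)
  rw [freeProb, this, probReal_univ]

/-- Resample the randomness of `k`: the deleted run is unchanged, so once the arrival time is fixed,
the survival of `k` is independent of whether its items are free. -/
theorem law_real_accepts (hc : Measurable c) (hF : ∀ q k, 0 ≤ F q k) (k : N) {T : Set I}
    (hT : MeasurableSet T) :
    (law x).real {ω | Accepts A (arrival ω) (Survives c K F ω) k ∧ arrival ω k ∈ T} =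
      x k * ∫ z in T, bitProb c K F k z * freeProb A x c K F k z := by
  have hS : MeasurableSet {ω | Accepts A (arrival ω) (Survives c K F ω) k ∧ arrival ω k ∈ T} :=
    (measurableSet_accepted A K F hc k).inter (measurable_arrival k hT)
  rw [law_real_update x k hS]
  have hm : Measurable fun z : I => freeProb A x c K F k z :=
    (freeProb_antitone A x K F k).measurable.comp measurable_subtype_coe
  have key := integral_productLaw (x k) (measurable_bitProb K F hc k) (hm.indicator hT)
    (fun z => le_min (div_nonneg (c z).2.1 (hF _ _)) zero_le_one) (fun z => min_le_right _ _)
    (fun z => Set.indicator_nonneg (fun _ _ => freeProb_nonneg ..) _)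
    (fun z => Set.indicator_apply_le' (fun _ => freeProb_le_one ..) (fun _ => zero_le_one))
  have hR : ∫ z in T, bitProb c K F k z * freeProb A x c K F k z =
      ∫ z, bitProb c K F k z * T.indicator (fun z : I => freeProb A x c K F k z) z := by
    rw [← integral_indicator hT]
    refine integral_congr_ae (ae_of_all _ fun z => ?_)
    by_cases h : z ∈ T <;> simp [h]
  rw [hR, ← key]
  refine integral_congr_ae (ae_of_all _ fun u => ?_)
  simp only [accepts_iff_free_without, without_update, arrival, Function.update_self,
    Survives, Active, seed, Set.mem_ofPred_eq]
  by_cases h1 : u.2.1 = true ∧ (u.2.2 : ℝ) ≤ bitProb c K F k u.1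
  · by_cases h2 : u.1 ∈ T
    · rw [Set.indicator_of_mem (by exact h1), Set.indicator_of_mem h2, freeProb]
      congr 1
      ext ω
      simp only [Set.mem_ofPred_eq, h2, and_true]
      exact and_iff_right h1
    · rw [Set.indicator_of_mem (by exact h1), Set.indicator_of_notMem h2]
      simp [h2]
  · rw [Set.indicator_of_notMem (by exact h1)]
    have : ∀ ω : Outcome N, ¬ (((u.2.1 = true ∧ (u.2.2 : ℝ) ≤
        min ((c u.1 : ℝ) / F (phase K u.1) k) 1) ∧ Free A c K F (without k ω) k u.1) ∧ u.1 ∈ T) :=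
      fun ω h => h1 h.1.1
    simp only [this]
    simp

/-- Freeness is lost between `y` and `z` only if an active product sharing an item with `k` arrives
in between. By the union bound each item contributes at most `z - y`, and there are at most `L`
items. -/
theorem freeProb_sub_le [DecidableEq M] {L : ℕ} (hx : IsInput L A x) (k : N)
    {y z : I} (hyz : y ≤ z) :
    freeProb A x c K F k y - freeProb A x c K F k z ≤ L * ((z : ℝ) - y) := by
  have hact (l : N) : (law x).real {ω | Active ω l ∧ arrival ω l ∈ Set.Ico y z} =
      x l * ((z : ℝ) - y) := by
    have := law_real_eval x l (S := {u | u.2.1 = true ∧ u.1 ∈ Set.Ico y z})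
      (((measurable_fst.comp measurable_snd) (measurableSet_singleton true)).inter
        (measurable_fst measurableSet_Ico))
    rw [productLaw_real_active] at this
    rw [Measure.real, Measure.real, unitInterval.volume_Ico, ENNReal.toReal_ofReal
      (sub_nonneg.2 (Subtype.coe_le_coe.2 hyz))] at this
    exact this
  have hsub : {ω | Free A c K F (without k ω) k y} ⊆ {ω | Free A c K F (without k ω) k z} ∪
      ⋃ i ∈ A k, ⋃ l ∈ ({l | i ∈ A l} : Finset N),
        {ω : Outcome N | Active ω l ∧ arrival ω l ∈ Set.Ico y z} := by
    intro ω hω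
    by_cases h : Free A c K F (without k ω) k z
    · exact Or.inl h
    · right
      simp only [Free, Available] at h
      push Not at h
      obtain ⟨i, hi, l, hl, ha, hil⟩ := h
      have hs := ((accepts_iff _ _ _ _).1 ha).1
      have hne : l ≠ k := fun e => not_active_without k ω (e ▸ hs.1)
      have e := without_of_ne hne ω
      simp only [Set.mem_iUnion]
      refine ⟨i, hi, l, by simpa using hil, ?_, ?_, ?_⟩
      · have := hs.1
        rwa [Active, e] at this
      · by_contra hy
        refine hω i hi l ?_ ha hil
        rw [arrival, e]
        exact not_le.1 hy
      · rw [arrival, e] at hl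
        exact hl
  have h1 := (measureReal_mono (μ := law x) hsub).trans (measureReal_union_le _ _)
  have h2 := (measureReal_biUnion_finset_le (μ := law x) (A k) fun i =>
    ⋃ l ∈ ({l | i ∈ A l} : Finset N), {ω : Outcome N | Active ω l ∧ arrival ω l ∈ Set.Ico y z})
  have hd : 0 ≤ (z : ℝ) - y := sub_nonneg.2 (Subtype.coe_le_coe.2 hyz)
  have h3 : ∀ i ∈ A k, (law x).real (⋃ l ∈ ({l | i ∈ A l} : Finset N),
      {ω : Outcome N | Active ω l ∧ arrival ω l ∈ Set.Ico y z}) ≤ (z : ℝ) - y := by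
    intro i _
    refine (measureReal_biUnion_finset_le _ _).trans ?_
    simp only [hact]
    rw [← Finset.sum_mul]
    exact mul_le_of_le_one_left hd (hx.feasible i)
  have h4 := h2.trans (Finset.sum_le_card_nsmul _ _ _ h3)
  rw [nsmul_eq_mul] at h4
  have h5 : ((A k).card : ℝ) * ((z : ℝ) - y) ≤ L * ((z : ℝ) - y) :=
    mul_le_mul_of_nonneg_right (by exact_mod_cast hx.card_le k) hd
  change freeProb A x c K F k y ≤ freeProb A x c K F k z + _ at h1
  linarith

/-- If `k` arrives after `q / K`, the run up to that time agrees with the run without `k`, which is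
independent of the conditioning event. That event has positive probability since `q < K`. -/
theorem feasProb_eq_freeProb (hc : Measurable c) {q : ℕ} (hq : q < K) (k : N) :
    feasProb A x c K q k = freeProb A x c K (feasProb A x c K) k (q / K) := by
  have hK : 0 < K := by omega
  have hK' : (0 : ℝ) < K := by exact_mod_cast hK
  cases q with
  | zero => rw [feasProb]; simp [freeProb_zero]
  | succ q =>
    rw [feasProb]
    set t : ℝ := ((q + 1 : ℕ) : ℝ) / K with ht
    have ht1 : t < 1 := by rw [ht, div_lt_one hK']; exact_mod_cast hq
    have ht0 : 0 ≤ t := by positivity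
    let T : Set I := Set.Ioi ⟨t, ht0, ht1.le⟩
    have hE : MeasurableSet {ω : Outcome N | t < arrival ω k} := measurable_arrival k
      (measurableSet_Ioi (a := (⟨t, ht0, ht1.le⟩ : I)))
    have hvol : volume.real T = 1 - t := by
      rw [Measure.real, unitInterval.volume_Ioi, ENNReal.toReal_ofReal (by simp [ht1.le])]
    have hmE : (law x).real {ω : Outcome N | t < arrival ω k} = 1 - t := by
      rw [← hvol, ← productLaw_real_arrival (x k) T]
      exact law_real_eval x k (S := {u | u.1 ∈ T}) (measurable_fst measurableSet_Ioi)
    have hint : {ω : Outcome N | t < arrival ω k} ∩ {ω | ∀ i ∈ A k, Available A (arrival ω)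
          (Survives c K (fun r => if _h : r < q + 1 then feasProb A x c K r else fun _ => 1) ω)
          i t} = {ω : Outcome N | t < arrival ω k} ∩
          {ω | Free A c K (feasProb A x c K) (without k ω) k t} := by
      ext ω
      simp only [Set.mem_inter_iff, Set.mem_ofPred_eq]
      refine and_congr_right fun hω => ?_
      rw [← free_iff_free_without fun h => absurd h (not_lt.2 hω.le)]
      -- Arrivals before `t` lie in phases up to `q`, where the truncated numbers of the recursion
      -- agree with `feasProb`.
      have hs : ∀ l, (arrival ω l : ℝ) < t → (Survives c K (fun r => if _h : r < q + 1 then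
          feasProb A x c K r else fun _ => 1) ω l ↔ Survives c K (feasProb A x c K) ω l) := by
        intro l hl
        have : phase K (arrival ω l) < q + 1 := Nat.lt_succ_of_le (phase_le hK hl)
        simp only [Survives, this, dif_pos]
      refine forall₂_congr fun i _ => available_congr (fun l hl ha => ⟨rfl, ?_⟩)
        (fun l hl h => ⟨rfl, (hs l hl).2 h⟩) i
      exact (hs l hl).1 ((accepts_iff _ _ _ _).1 ha).1
    beta_reduce
    rw [measureReal_def, cond_apply hE, hint, ENNReal.toReal_mul, ENNReal.toReal_inv]
    change ((law x).real _)⁻¹ * (law x).real _ = _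
    rw [law_real_update x k (hE.inter (measurableSet_free_without A K _ hc k t)), hmE]
    have : ∀ u : I × Bool × I, (law x).real {ω | Function.update ω k u ∈
        {ω : Outcome N | t < arrival ω k} ∩
          {ω | Free A c K (feasProb A x c K) (without k ω) k t}} =
        {u : I × Bool × I | u.1 ∈ T}.indicator
          (fun _ => freeProb A x c K (feasProb A x c K) k t) u := by
      intro u
      simp only [Set.mem_inter_iff, Set.mem_ofPred_eq, without_update, arrival,
        Function.update_self]
      by_cases h : u.1 ∈ T
      · rw [Set.indicator_of_mem (by exact h), freeProb]
        congr 1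
        ext ω
        exact and_iff_right h
      · rw [Set.indicator_of_notMem (by exact h)]
        have h' : ¬ t < (u.1 : ℝ) := h
        simp [h']
    simp only [this]
    rw [integral_indicator_const _ (show MeasurableSet {u : I × Bool × I | u.1 ∈ T} from
        measurable_fst measurableSet_Ioi),
      productLaw_real_arrival, hvol, smul_eq_mul]
    field_simp [(sub_pos.2 ht1).ne']

end Scheme

/-! ### Almost sure disjointness, and joint acceptance of two disjoint products -/

section Pairs

variable {M N : Type*} [Fintype N] [DecidableEq N] {A : N → Finset M} (x : N → I) {c : I → I}
  {K : ℕ} {F : ℕ → N → ℝ}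

theorem ae_arrival_injective : ∀ᵐ ω ∂law x, Function.Injective (arrival ω) := by
  have : ∀ j j' : N, ∀ᵐ ω ∂law x, arrival ω j = arrival ω j' → j = j' := by
    intro j j'
    by_cases h : j = j'
    · exact ae_of_all _ fun _ _ => h
    · rw [ae_iff]
      have hS : MeasurableSet {ω : Outcome N | arrival ω j = arrival ω j'} :=
        measurableSet_eq_fun (measurable_arrival j) (measurable_arrival j')
      simp only [h, imp_false, not_not]
      rw [law_apply_update x j' hS]
      have h0 (ω : Outcome N) : productLaw (x j') {u | arrival ω j = u.1} = 0 := by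
        have : {u : I × Bool × I | arrival ω j = u.1} = {arrival ω j} ×ˢ Set.univ := by
          ext u; simp [eq_comm]
        rw [this, productLaw, Measure.prod_prod]
        simp
      have hT : MeasurableSet {p : Outcome N × (I × Bool × I) | arrival p.1 j = p.2.1} :=
        measurableSet_eq_fun ((measurable_arrival j).comp measurable_fst)
          (measurable_fst.comp measurable_snd)
      have h1 := Measure.prod_apply (μ := law x) (ν := productLaw (x j')) hT
      rw [Measure.prod_apply_symm hT] at h1
      have h2 : ∀ u : I × Bool × I, {ω : Outcome N | Function.update ω j' u ∈
          {ω : Outcome N | arrival ω j = arrival ω j'}} = (fun ω => (ω, u)) ⁻¹'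
          {p : Outcome N × (I × Bool × I) | arrival p.1 j = p.2.1} := by
        intro u
        ext ω
        simp [arrival, Function.update_of_ne h]
      simp only [h2]
      rw [h1]
      refine lintegral_eq_zero_of_ae_eq_zero (ae_of_all _ h0)
  filter_upwards [ae_all_iff.2 fun j => ae_all_iff.2 (this j)] with ω h j j' using h j j'

omit [Fintype N] [DecidableEq N] in
theorem disjoint_of_accepts [Finite N] {y : N → I} {s : N → Prop} (hy : Function.Injective y)
    {j j' : N} (hj : j ≠ j') (h : Accepts A y s j) (h' : Accepts A y s j') :
    Disjoint (A j) (A j') := by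
  rw [Finset.disjoint_left]
  rcases lt_or_gt_of_ne (hy.ne hj) with hlt | hlt
  · exact fun i hi hi' => ((accepts_iff _ _ _ _).1 h').2 i hi' j hlt h hi
  · exact fun i hi => ((accepts_iff _ _ _ _).1 h).2 i hi j' hlt h'

theorem one_sub_sum_le_prod_one_sub {ι : Type*} (s : Finset ι) {f : ι → ℝ}
    (h0 : ∀ i ∈ s, 0 ≤ f i) (h1 : ∀ i ∈ s, f i ≤ 1) :
    1 - ∑ i ∈ s, f i ≤ ∏ i ∈ s, (1 - f i) := by
  classical
  induction s using Finset.induction_on with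
  | empty => simp
  | insert a s ha ih =>
    rw [Finset.sum_insert ha, Finset.prod_insert ha]
    have h2 := ih (fun i hi => h0 i (Finset.mem_insert_of_mem hi))
      fun i hi => h1 i (Finset.mem_insert_of_mem hi)
    have h3 : ∏ i ∈ s, (1 - f i) ≤ 1 := Finset.prod_le_one
      (fun i hi => sub_nonneg.2 (h1 i (Finset.mem_insert_of_mem hi)))
      fun i hi => sub_le_self _ (h0 i (Finset.mem_insert_of_mem hi))
    have h4 := mul_le_mul_of_nonneg_left h3 (h0 a (Finset.mem_insert_self _ _))
    linarith

variable [DecidableEq M] {x}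

omit [DecidableEq N] in
/-- A lower bound on the probability that no active product that shares an item with `l` arrives
before time `z`. -/
theorem one_sub_pow_le_prod {L : ℕ} (hx : IsInput L A x) (l : N) (z : I) :
    (1 - (z : ℝ)) ^ L ≤ ∏ m, (1 - (x m : ℝ) * if Disjoint (A m) (A l) then 0 else (z : ℝ)) := by
  have hz : 0 ≤ 1 - (z : ℝ) := sub_nonneg.2 z.2.2
  have hxz (m : N) : 0 ≤ (x m : ℝ) * z := mul_nonneg (x m).2.1 z.2.1
  have hxz1 (m : N) : (x m : ℝ) * z ≤ 1 := mul_le_one₀ (x m).2.2 z.2.1 z.2.2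
  -- If `m` meets `l`, one shared item already gives the factor on the right; further shared items
  -- only decrease the left side.
  have h1 (m : N) : ∏ i ∈ A l, (if i ∈ A m then 1 - (x m : ℝ) * z else 1) ≤
      1 - (x m : ℝ) * if Disjoint (A m) (A l) then 0 else (z : ℝ) := by
    have hle : ∀ i, (if i ∈ A m then 1 - (x m : ℝ) * z else 1) ≤ 1 := fun i => by
      split_ifs
      · linarith [hxz m]
      · exact le_rfl
    have hge : ∀ i, 0 ≤ (if i ∈ A m then 1 - (x m : ℝ) * z else 1) := fun i => by
      split_ifs
      · linarith [hxz1 m]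
      · exact zero_le_one
    split_ifs with hd
    · simpa using Finset.prod_le_one (fun i _ => hge i) fun i _ => hle i
    · obtain ⟨i, him, hil⟩ := Finset.not_disjoint_iff.1 hd
      rw [← Finset.mul_prod_erase _ _ hil, if_pos him]
      exact mul_le_of_le_one_right (by linarith [hxz1 m])
        (Finset.prod_le_one (fun i _ => hge i) fun i _ => hle i)
  -- The product is at least one minus the total mass on item `i` times `z`, and that mass is at
  -- most `1`.
  have h2 (i : M) : 1 - (z : ℝ) ≤ ∏ m, (if i ∈ A m then 1 - (x m : ℝ) * z else 1) := by
    rw [← Finset.prod_filter]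
    refine le_trans ?_ (one_sub_sum_le_prod_one_sub _ (fun m _ => hxz m) fun m _ => hxz1 m)
    rw [← Finset.sum_mul]
    have := mul_le_of_le_one_left z.2.1 (hx.feasible i)
    linarith
  calc (1 - (z : ℝ)) ^ L ≤ (1 - (z : ℝ)) ^ (A l).card :=
        pow_le_pow_of_le_one hz (by linarith [z.2.1]) (hx.card_le l)
    _ = ∏ i ∈ A l, (1 - (z : ℝ)) := by rw [Finset.prod_const]
    _ ≤ ∏ i ∈ A l, ∏ m, (if i ∈ A m then 1 - (x m : ℝ) * z else 1) :=
        Finset.prod_le_prod (fun _ _ => hz) fun i _ => h2 i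
    _ = ∏ m, ∏ i ∈ A l, (if i ∈ A m then 1 - (x m : ℝ) * z else 1) := Finset.prod_comm
    _ ≤ _ := Finset.prod_le_prod (fun m _ => Finset.prod_nonneg fun i _ => by
        split_ifs
        · linarith [hxz1 m]
        · exact zero_le_one) fun m _ => h1 m

/-- With the data of `l` and `l'` fixed so that both survive, both are accepted as soon as no other
active product meeting either of them arrives earlier than it. This sufficient event is independent
across the other products. -/
theorem law_real_update_pair_ge {L : ℕ} (hx : IsInput L A x) {t : I}
    (hF : ∀ k, ∀ z < t, (c z : ℝ) ≤ bitProb c K F k z) {l l' : N} (hl : l ≠ l')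
    (hd : Disjoint (A l) (A l')) {u u' : I × Bool × I} (hu : u.2.1 = true ∧ (u.2.2 : ℝ) ≤ c u.1)
    (hu' : u'.2.1 = true ∧ (u'.2.2 : ℝ) ≤ c u'.1) (ht : u.1 < t) (ht' : u'.1 < t) :
    (1 - (u.1 : ℝ)) ^ L * (1 - (u'.1 : ℝ)) ^ L ≤ (law x).real
      {ω | Function.update (Function.update ω l' u') l u ∈
        {ω | (Accepts A (arrival ω) (Survives c K F ω) l ∧ arrival ω l ∈ Set.Iio t) ∧
          (Accepts A (arrival ω) (Survives c K F ω) l' ∧ arrival ω l' ∈ Set.Iio t)}} := by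
  -- `a m` and `b m` are the times before which `m` must not arrive active, for the sake of `l` and
  -- of `l'`; the value `0` imposes nothing.
  let a (m : N) : I := if Disjoint (A m) (A l) then 0 else u.1
  let b (m : N) : I := if Disjoint (A m) (A l') then 0 else u'.1
  let S (m : N) : Set (I × Bool × I) :=
    if m = l ∨ m = l' then Set.univ else {v | v.2.1 = true ∧ v.1 ∈ Set.Iio (max (a m) (b m))}ᶜ
  have hS (m : N) : (1 - (x m : ℝ) * a m) * (1 - (x m : ℝ) * b m) ≤ (productLaw (x m)).real (S m) := by
    have ha : 0 ≤ (x m : ℝ) * a m := mul_nonneg (x m).2.1 (a m).2.1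
    have hb : 0 ≤ (x m : ℝ) * b m := mul_nonneg (x m).2.1 (b m).2.1
    have ha1 : (x m : ℝ) * a m ≤ 1 := mul_le_one₀ (x m).2.2 (a m).2.1 (a m).2.2
    have hb1 : (x m : ℝ) * b m ≤ 1 := mul_le_one₀ (x m).2.2 (b m).2.1 (b m).2.2
    simp only [S]
    split_ifs with h
    · rw [probReal_univ]
      nlinarith
    · have hm : MeasurableSet {v : I × Bool × I | v.2.1 = true ∧ v.1 ∈ Set.Iio (max (a m) (b m))} :=
        ((measurable_fst.comp measurable_snd) (measurableSet_singleton true)).inter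
          (measurable_fst measurableSet_Iio)
      rw [probReal_compl_eq_one_sub hm, productLaw_real_active, measureReal_def,
        unitInterval.volume_Iio, ENNReal.toReal_ofReal (max (a m) (b m)).2.1]
      -- A product that threatens both `l` and `l'` is avoided with probability `1 - x m * max (a m)
      -- (b m)`, which is at least the product of the two separate probabilities.
      rcases max_choice (a m) (b m) with h | h <;> rw [h] <;> nlinarith
  have hsub : Set.univ.pi S ⊆ {ω | Function.update (Function.update ω l' u') l u ∈
        {ω | (Accepts A (arrival ω) (Survives c K F ω) l ∧ arrival ω l ∈ Set.Iio t) ∧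
          (Accepts A (arrival ω) (Survives c K F ω) l' ∧ arrival ω l' ∈ Set.Iio t)}} := by
    intro ω hω
    set ω' := Function.update (Function.update ω l' u') l u with hω'
    have e1 : ω' l = u := by simp [hω']
    have e2 : ω' l' = u' := by simp [hω', Function.update_of_ne hl.symm]
    have e3 : ∀ m, m ≠ l → m ≠ l' → ω' m = ω m := fun m h h' => by
      simp [hω', Function.update_of_ne h, Function.update_of_ne h']
    have hno : ∀ m, m ≠ l → m ≠ l' → Active ω' m → ¬ arrival ω' m < max (a m) (b m) := by
      intro m h h' hact hlt
      have := hω m trivial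
      simp only [S, h, h', or_self, if_false] at this
      rw [Active, e3 m h h'] at hact
      rw [arrival, e3 m h h'] at hlt
      exact this ⟨hact, hlt⟩
    have t1 : arrival ω' l = u.1 := by rw [arrival, e1]
    have t2 : arrival ω' l' = u'.1 := by rw [arrival, e2]
    have s1 : Survives c K F ω' l := by
      refine ⟨by rw [Active, e1]; exact hu.1, ?_⟩
      rw [seed, t1, e1]
      exact hu.2.trans (hF l _ ht)
    have s2 : Survives c K F ω' l' := by
      refine ⟨by rw [Active, e2]; exact hu'.1, ?_⟩
      rw [seed, t2, e2]
      exact hu'.2.trans (hF l' _ ht')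
    refine ⟨⟨(accepts_iff _ _ _ _).2 ⟨s1, fun i hi m hm hacc him => ?_⟩, by rw [t1]; exact ht⟩,
      ⟨(accepts_iff _ _ _ _).2 ⟨s2, fun i hi m hm hacc him => ?_⟩, by rw [t2]; exact ht'⟩⟩
    · have h : m ≠ l := fun e => lt_irrefl _ (e ▸ hm)
      have h' : m ≠ l' := fun e => Finset.disjoint_left.1 hd hi (e ▸ him)
      refine hno m h h' ((accepts_iff _ _ _ _).1 hacc).1.1 (lt_of_lt_of_le hm (le_max_of_le_left ?_))
      rw [t1]
      simp only [a]
      rw [if_neg (Finset.not_disjoint_iff.2 ⟨i, him, hi⟩)]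
    · have h : m ≠ l := fun e => Finset.disjoint_left.1 hd (e ▸ him) hi
      have h' : m ≠ l' := fun e => lt_irrefl _ (e ▸ hm)
      refine hno m h h' ((accepts_iff _ _ _ _).1 hacc).1.1 (lt_of_lt_of_le hm (le_max_of_le_right ?_))
      rw [t2]
      simp only [b]
      rw [if_neg (Finset.not_disjoint_iff.2 ⟨i, him, hi⟩)]
  refine le_trans ?_ (measureReal_mono hsub)
  rw [law_eq_pi, measureReal_def, Measure.pi_pi, ENNReal.toReal_prod]
  have h1 := one_sub_pow_le_prod hx l u.1
  have h2 := one_sub_pow_le_prod hx l' u'.1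
  have h1' (m : N) : (1 - (x m : ℝ) * if Disjoint (A m) (A l) then 0 else (u.1 : ℝ)) =
      1 - (x m : ℝ) * a m := by simp only [a]; split_ifs <;> simp
  have h2' (m : N) : (1 - (x m : ℝ) * if Disjoint (A m) (A l') then 0 else (u'.1 : ℝ)) =
      1 - (x m : ℝ) * b m := by simp only [b]; split_ifs <;> simp
  simp only [h1'] at h1
  simp only [h2'] at h2
  have hn (z : I) : 0 ≤ (1 - (z : ℝ)) ^ L := pow_nonneg (sub_nonneg.2 z.2.2) _
  have hn' (m : N) (z : I) : 0 ≤ 1 - (x m : ℝ) * z :=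
    sub_nonneg.2 (mul_le_one₀ (x m).2.2 z.2.1 z.2.2)
  refine (mul_le_mul h1 h2 (hn _) (Finset.prod_nonneg fun m _ => hn' m _)).trans ?_
  rw [← Finset.prod_mul_distrib]
  exact Finset.prod_le_prod (fun m _ => mul_nonneg (hn' _ _) (hn' _ _)) fun m _ => hS m

-- Resampling `l` and then `l'` integrates the bound of `law_real_update_pair_ge` over both. Only
-- seeds at most `c` of the arrival time are counted; by `hF` these make the bit `1`.
omit [DecidableEq N] in
theorem law_real_accepts_pair_ge (hc : Measurable c) {L : ℕ} (hx : IsInput L A x) {t : I}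
    (hF : ∀ k, ∀ z < t, (c z : ℝ) ≤ bitProb c K F k z) {l l' : N} (hl : l ≠ l')
    (hd : Disjoint (A l) (A l')) :
    (x l : ℝ) * x l' * (∫ z in Set.Iio t, (c z : ℝ) * (1 - (z : ℝ)) ^ L) ^ 2 ≤ (law x).real
      ({ω | Accepts A (arrival ω) (Survives c K F ω) l ∧ arrival ω l ∈ Set.Iio t} ∩
        {ω | Accepts A (arrival ω) (Survives c K F ω) l' ∧ arrival ω l' ∈ Set.Iio t}) := by
  classical
  have hS1 (l : N) : MeasurableSet
      {ω | Accepts A (arrival ω) (Survives c K F ω) l ∧ arrival ω l ∈ Set.Iio t} :=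
    (measurableSet_accepted A K F hc l).inter (measurable_arrival l measurableSet_Iio)
  have hS := (hS1 l).inter (hS1 l')
  let g : I → ℝ := (Set.Iio t).indicator fun z => (1 - (z : ℝ)) ^ L
  have hgm : Measurable g := ((measurable_const.sub measurable_subtype_coe).pow_const L).indicator
    measurableSet_Iio
  have hg0 : ∀ z, 0 ≤ g z := fun z =>
    Set.indicator_nonneg (fun z _ => pow_nonneg (sub_nonneg.2 z.2.2) _) _
  have hg1 : ∀ z, g z ≤ 1 := fun z => Set.indicator_apply_le'
    (fun _ => pow_le_one₀ (sub_nonneg.2 z.2.2) (sub_le_self _ z.2.1)) fun _ => zero_le_one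
  let C : Set (I × Bool × I) := {u | u.2.1 = true ∧ (u.2.2 : ℝ) ≤ c u.1}
  have hC : MeasurableSet C := MeasurableSet.inter
    ((measurable_fst.comp measurable_snd) (measurableSet_singleton true))
    (measurableSet_le (measurable_subtype_coe.comp (measurable_snd.comp measurable_snd))
        (measurable_subtype_coe.comp (hc.comp measurable_fst)))
  let G : I × Bool × I → ℝ := C.indicator fun u => g u.1
  have hGm : Measurable G := (hgm.comp measurable_fst).indicator hC
  have hG0 : ∀ u, 0 ≤ G u := Set.indicator_nonneg fun _ _ => hg0 _
  have hG1 : ∀ u, G u ≤ 1 := fun u => Set.indicator_apply_le' (fun _ => hg1 _) fun _ => zero_le_one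
  have hGi (k : N) : Integrable G (productLaw (x k)) :=
    Integrable.of_bound hGm.aestronglyMeasurable 1 (ae_of_all _ fun u => by
      rw [Real.norm_eq_abs, abs_of_nonneg (hG0 u)]; exact hG1 u)
  have hGint (k : N) : ∫ u, G u ∂productLaw (x k) =
      x k * ∫ z in Set.Iio t, (c z : ℝ) * (1 - (z : ℝ)) ^ L := by
    have e := integral_productLaw (x k) (v := fun z => (c z : ℝ)) (measurable_subtype_coe.comp hc)
      hgm (fun z => (c z).2.1) (fun z => (c z).2.2) hg0 hg1
    refine e.trans ?_
    rw [← integral_indicator measurableSet_Iio]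
    congr 2
    ext z
    by_cases h : z ∈ Set.Iio t <;> simp [g, h]
  have hmi (k : N) {S : Set (Outcome N)} (hS : MeasurableSet S) :
      Integrable (fun u => (law x).real {ω | Function.update ω k u ∈ S}) (productLaw (x k)) :=
    Integrable.of_bound (measurable_law_update x k hS).aestronglyMeasurable 1
      (ae_of_all _ fun u => by
        rw [Real.norm_eq_abs, abs_of_nonneg measureReal_nonneg]; exact measureReal_le_one)
  have hin : ∀ u, G u * (x l' * ∫ z in Set.Iio t, (c z : ℝ) * (1 - (z : ℝ)) ^ L) ≤
      (law x).real {ω | Function.update ω l u ∈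
        ({ω | Accepts A (arrival ω) (Survives c K F ω) l ∧ arrival ω l ∈ Set.Iio t} ∩
        {ω | Accepts A (arrival ω) (Survives c K F ω) l' ∧ arrival ω l' ∈ Set.Iio t})} := by
    intro u
    have hSu := (measurable_update_prod l |>.comp (measurable_prodMk_right (y := u))) hS
    have e := law_real_update x l' hSu
    refine le_of_le_of_eq ?_ e.symm
    rw [← hGint l', ← integral_const_mul]
    refine integral_mono ((hGi l').const_mul _) (hmi l' hSu) fun u' => ?_
    by_cases hu : u ∈ C ∧ u.1 < t ∧ u' ∈ C ∧ u'.1 < t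
    · have := law_real_update_pair_ge hx hF hl hd hu.1 hu.2.2.1 hu.2.1 hu.2.2.2
      simp only [G]
      rw [Set.indicator_of_mem hu.1, Set.indicator_of_mem hu.2.2.1]
      simp only [g]
      rw [Set.indicator_of_mem (by exact hu.2.1), Set.indicator_of_mem (by exact hu.2.2.2)]
      exact this
    · have : G u * G u' = 0 := by
        by_contra hne
        have h1 := left_ne_zero_of_mul hne
        have h2 := right_ne_zero_of_mul hne
        have k1 := Set.mem_of_indicator_ne_zero h1
        have k2 := Set.mem_of_indicator_ne_zero h2
        simp only [G] at h1 h2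
        rw [Set.indicator_of_mem k1] at h1
        rw [Set.indicator_of_mem k2] at h2
        exact hu ⟨k1, Set.mem_of_indicator_ne_zero (s := Set.Iio t) h1, k2,
          Set.mem_of_indicator_ne_zero (s := Set.Iio t) h2⟩
      simp only [this]
      exact measureReal_nonneg
  have := integral_mono ((hGi l).mul_const _) (hmi l hS) hin
  rw [integral_mul_const, hGint, ← law_real_update x l hS] at this
  refine le_of_eq_of_le ?_ this
  ring

end Pairs

/-! ### Masses of neighbors and of disjoint pairs of neighbors -/

section Combinatorics

theorem sum_sum_mul_sum_eq_sum_sq {ι κ : Type*} (s : Finset ι) (T : Finset κ) (f : ι → ℝ)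
    (e : κ → ι → ℝ) :
    ∑ l ∈ s, ∑ l' ∈ s, f l * f l' * ∑ i ∈ T, e i l * e i l' =
      ∑ i ∈ T, (∑ l ∈ s, f l * e i l) ^ 2 := by
  simp_rw [sq, Finset.sum_mul_sum, Finset.mul_sum]
  symm
  rw [Finset.sum_comm]
  refine Finset.sum_congr rfl fun l _ => ?_
  rw [Finset.sum_comm]
  exact Finset.sum_congr rfl fun i _ => Finset.sum_congr rfl fun l' _ => by ring

variable {M N : Type*} [DecidableEq M] [Fintype N]

/-- The products that share an item with `k`. -/
def neighbors (A : N → Finset M) (k : N) : Finset N := {l | 1 ≤ (A l ∩ A k).card}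

/-- The products that share exactly one item with `k`. -/
def simpleNeighbors (A : N → Finset M) (k : N) : Finset N := {l | (A l ∩ A k).card = 1}

variable {A : N → Finset M} {x : N → I} {L : ℕ}

theorem simpleNeighbors_subset (k : N) : simpleNeighbors A k ⊆ neighbors A k := by
  intro l
  simp only [simpleNeighbors, neighbors, Finset.mem_filter, Finset.mem_univ, true_and]
  exact fun h => h.ge

/-- Summing feasibility over the items of `k` weights each `x l` by the intersection size, for a
total of at most `L`. Neighbors that are not simple have weight at least `2`. -/
theorem two_mul_sum_neighbors_le (hx : IsInput L A x) (k : N) :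
    2 * ∑ l ∈ neighbors A k, (x l : ℝ) ≤ L + ∑ l ∈ simpleNeighbors A k, (x l : ℝ) := by
  have h1 : ∑ l, ((A l ∩ A k).card : ℝ) * x l ≤ L := by
    have : ∀ l, ((A l ∩ A k).card : ℝ) * x l = ∑ i ∈ A k, if i ∈ A l then (x l : ℝ) else 0 := by
      intro l
      rw [← Finset.sum_filter, Finset.sum_const, nsmul_eq_mul, Finset.inter_comm,
        Finset.filter_mem_eq_inter]
    simp_rw [this]
    rw [Finset.sum_comm]
    calc _ ≤ ∑ i ∈ A k, (1 : ℝ) := Finset.sum_le_sum fun i _ => by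
          rw [← Finset.sum_filter]; exact hx.feasible i
      _ ≤ L := by simpa using hx.card_le k
  rw [neighbors, simpleNeighbors, Finset.sum_filter, Finset.sum_filter, ← sub_le_iff_le_add,
    Finset.mul_sum, ← Finset.sum_sub_distrib]
  refine le_trans (Finset.sum_le_sum fun l _ => ?_) h1
  have hxl := (x l).2.1
  rcases Nat.lt_or_ge (A l ∩ A k).card 1 with h | h
  · have h0 : (A l ∩ A k).card = 0 := by omega
    simp [h0]
  · rcases h.eq_or_lt with h | h
    · simp [← h]; linarith
    · rw [if_pos h.le, if_neg (by omega), sub_zero]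
      exact mul_le_mul_of_nonneg_right (by exact_mod_cast h) hxl

/-- Among the products that share exactly one item with `k`, many pairs are disjoint. -/
theorem sum_disjoint_pairs_ge (hL : 1 ≤ L) (hx : IsInput L A x) (k : N) :
    (∑ l ∈ simpleNeighbors A k, (x l : ℝ)) ^ 2 - ∑ l ∈ simpleNeighbors A k, (x l : ℝ)
        - ((L : ℝ) - 1) ^ 2 / L * ∑ l ∈ simpleNeighbors A k, (x l : ℝ) ≤
      ∑ l ∈ simpleNeighbors A k, ∑ l' ∈ simpleNeighbors A k,
        if Disjoint (A l) (A l') then (x l : ℝ) * x l' else 0 := by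
  set s := simpleNeighbors A k with hs
  let e (i : M) (l : N) : ℝ := if i ∈ A l then 1 else 0
  let U : Finset M := (Finset.univ.biUnion A) \ A k
  have hL0 : (0 : ℝ) < L := by exact_mod_cast hL
  have he0 : ∀ i l, 0 ≤ e i l := fun i l => by simp only [e]; split_ifs <;> simp
  have hsum : ∀ l ∈ s, ∑ i ∈ A k, e i l = 1 := by
    intro l hl
    simp only [hs, simpleNeighbors, Finset.mem_filter, Finset.mem_univ, true_and] at hl
    simp only [e]
    rw [← Finset.sum_filter, Finset.filter_mem_eq_inter, Finset.inter_comm]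
    simp [hl]
  have hmass : ∀ i, ∑ l ∈ s, (x l : ℝ) * e i l ≤ 1 := by
    intro i
    refine le_trans ?_ (hx.feasible i)
    rw [Finset.sum_filter]
    refine (Finset.sum_le_univ_sum_of_nonneg fun l => mul_nonneg (x l).2.1 (he0 i l)).trans ?_
    refine Finset.sum_le_sum fun l _ => ?_
    simp only [e]; split_ifs <;> simp
  have hmass0 : ∀ i, 0 ≤ ∑ l ∈ s, (x l : ℝ) * e i l :=
    fun i => Finset.sum_nonneg fun l _ => mul_nonneg (x l).2.1 (he0 i l)
  -- A pair that is not disjoint either meets `k` in the same item, making the second term `1`, or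
  -- meets `k` in different items and shares some `m` outside `A k`. The factor `1 - ∑` keeps pairs
  -- of the first kind from being charged again for outside items.
  have hpt : ∀ l ∈ s, ∀ l' ∈ s, (1 : ℝ) ≤ (if Disjoint (A l) (A l') then 1 else 0)
      + ∑ i ∈ A k, e i l * e i l'
      + ∑ m ∈ U, e m l * e m l' * (1 - ∑ i ∈ A k, e i l * e i l') := by
    intro l hl l' hl'
    have hσ0 : 0 ≤ ∑ i ∈ A k, e i l * e i l' :=
      Finset.sum_nonneg fun i _ => mul_nonneg (he0 _ _) (he0 _ _)
    have hσ1 : ∑ i ∈ A k, e i l * e i l' ≤ 1 := by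
      rw [← hsum l hl]
      refine Finset.sum_le_sum fun i _ => mul_le_of_le_one_right (he0 _ _) ?_
      simp only [e]; split_ifs <;> simp
    have hτ0 : 0 ≤ ∑ m ∈ U, e m l * e m l' * (1 - ∑ i ∈ A k, e i l * e i l') :=
      Finset.sum_nonneg fun m _ => mul_nonneg (mul_nonneg (he0 _ _) (he0 _ _)) (by linarith)
    by_cases hd : Disjoint (A l) (A l')
    · rw [if_pos hd]; linarith
    · rw [if_neg hd]
      obtain ⟨m, hm, hm'⟩ := Finset.not_disjoint_iff.1 hd
      have hem : e m l * e m l' = 1 := by simp [e, hm, hm']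
      by_cases hmk : m ∈ A k
      · have := Finset.single_le_sum (f := fun i => e i l * e i l')
          (fun i _ => mul_nonneg (he0 _ _) (he0 _ _)) hmk
        simp only [hem] at this
        linarith
      · have hmU : m ∈ U := by
          simp only [U, Finset.mem_sdiff, Finset.mem_biUnion, Finset.mem_univ, true_and]
          exact ⟨⟨l, hm⟩, hmk⟩
        have := Finset.single_le_sum
          (f := fun m => e m l * e m l' * (1 - ∑ i ∈ A k, e i l * e i l'))
          (fun i _ => mul_nonneg (mul_nonneg (he0 _ _) (he0 _ _)) (by linarith)) hmU
        simp only [hem] at this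
        linarith
  have hA : (∑ l ∈ s, (x l : ℝ)) ^ 2 ≤
      (∑ l ∈ s, ∑ l' ∈ s, if Disjoint (A l) (A l') then (x l : ℝ) * x l' else 0)
      + ∑ i ∈ A k, (∑ l ∈ s, (x l : ℝ) * e i l) ^ 2
      + ∑ m ∈ U, ((∑ l ∈ s, (x l : ℝ) * e m l) ^ 2
        - ∑ i ∈ A k, (∑ l ∈ s, (x l : ℝ) * e m l * e i l) ^ 2) := by
    have hR : ∀ m, (∑ l ∈ s, (x l : ℝ) * e m l) ^ 2
        - ∑ i ∈ A k, (∑ l ∈ s, (x l : ℝ) * e m l * e i l) ^ 2 =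
        ∑ l ∈ s, ∑ l' ∈ s, (x l * x l' : ℝ) *
          (e m l * e m l' * (1 - ∑ i ∈ A k, e i l * e i l')) := by
      intro m
      rw [← sum_sum_mul_sum_eq_sum_sq s (A k) (fun l => (x l : ℝ) * e m l) e, sq,
        Finset.sum_mul_sum, ← Finset.sum_sub_distrib]
      refine Finset.sum_congr rfl fun l _ => ?_
      rw [← Finset.sum_sub_distrib]
      exact Finset.sum_congr rfl fun l' _ => by ring
    simp_rw [hR]
    rw [Finset.sum_comm (s := U), ← sum_sum_mul_sum_eq_sum_sq s (A k) (fun l => (x l : ℝ)) e, sq,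
      Finset.sum_mul_sum, ← Finset.sum_add_distrib, ← Finset.sum_add_distrib]
    refine Finset.sum_le_sum fun l hl => ?_
    rw [Finset.sum_comm (s := U), ← Finset.sum_add_distrib, ← Finset.sum_add_distrib]
    refine Finset.sum_le_sum fun l' hl' => ?_
    have := mul_le_mul_of_nonneg_left (hpt l hl l' hl') (mul_nonneg (x l).2.1 (x l').2.1)
    rw [mul_one, mul_add, mul_add, mul_ite, mul_one, mul_zero, Finset.mul_sum (s := U)] at this
    exact this
  -- Each item carries mass at most `1`, so its square is at most itself; each simple neighbor lies
  -- over exactly one item of `A k`.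
  have hB : ∑ i ∈ A k, (∑ l ∈ s, (x l : ℝ) * e i l) ^ 2 ≤ ∑ l ∈ s, (x l : ℝ) := by
    calc _ ≤ ∑ i ∈ A k, ∑ l ∈ s, (x l : ℝ) * e i l := Finset.sum_le_sum fun i _ => by
          rw [sq]; exact mul_le_of_le_one_left (hmass0 i) (hmass i)
      _ = ∑ l ∈ s, (x l : ℝ) * ∑ i ∈ A k, e i l := by
          rw [Finset.sum_comm]; simp_rw [Finset.mul_sum]
      _ = _ := Finset.sum_congr rfl fun l hl => by rw [hsum l hl, mul_one]
  -- The mass on `m` splits according to the item shared with `k` into at most `L` classes. By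
  -- Cauchy–Schwarz, pairs within one class account for at least the fraction `1 / L` of the squared
  -- mass.
  have hC : ∀ m, (∑ l ∈ s, (x l : ℝ) * e m l) ^ 2
        - ∑ i ∈ A k, (∑ l ∈ s, (x l : ℝ) * e m l * e i l) ^ 2 ≤
        (1 - 1 / L) * ∑ l ∈ s, (x l : ℝ) * e m l := by
    intro m
    have h1 : ∑ l ∈ s, (x l : ℝ) * e m l = ∑ i ∈ A k, ∑ l ∈ s, (x l : ℝ) * e m l * e i l := by
      rw [Finset.sum_comm]
      refine Finset.sum_congr rfl fun l hl => ?_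
      rw [← Finset.mul_sum, hsum l hl, mul_one]
    have h2 := sq_sum_le_card_mul_sum_sq (s := A k)
      (f := fun i => ∑ l ∈ s, (x l : ℝ) * e m l * e i l)
    rw [← h1] at h2
    have h3 : 0 ≤ ∑ i ∈ A k, (∑ l ∈ s, (x l : ℝ) * e m l * e i l) ^ 2 :=
      Finset.sum_nonneg fun _ _ => sq_nonneg _
    have h4 : ((A k).card : ℝ) ≤ L := by exact_mod_cast hx.card_le k
    have h5 : (∑ l ∈ s, (x l : ℝ) * e m l) ^ 2 / L ≤
        ∑ i ∈ A k, (∑ l ∈ s, (x l : ℝ) * e m l * e i l) ^ 2 := by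
      rw [div_le_iff₀ hL0, mul_comm]
      exact h2.trans (mul_le_mul_of_nonneg_right h4 h3)
    have h6 : (∑ l ∈ s, (x l : ℝ) * e m l) ^ 2 ≤ ∑ l ∈ s, (x l : ℝ) * e m l := by
      rw [sq]; exact mul_le_of_le_one_left (hmass0 m) (hmass m)
    have h7 : 0 ≤ 1 - 1 / (L : ℝ) := by
      rw [sub_nonneg, div_le_one hL0]; exact_mod_cast hL
    have h8 := mul_le_mul_of_nonneg_left h6 h7
    have h9 : (1 - 1 / (L : ℝ)) * (∑ l ∈ s, (x l : ℝ) * e m l) ^ 2 =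
      (∑ l ∈ s, (x l : ℝ) * e m l) ^ 2 - (∑ l ∈ s, (x l : ℝ) * e m l) ^ 2 / L := by ring
    linarith
  -- A simple neighbor has one item in `A k`, hence at most `L - 1` outside.
  have hD : ∑ m ∈ U, ∑ l ∈ s, (x l : ℝ) * e m l ≤ (L - 1) * ∑ l ∈ s, (x l : ℝ) := by
    rw [Finset.sum_comm, Finset.mul_sum]
    refine Finset.sum_le_sum fun l hl => ?_
    rw [← Finset.mul_sum, mul_comm]
    refine mul_le_mul_of_nonneg_right ?_ (x l).2.1
    have h1 : ∑ m ∈ U, e m l = ((A l \ A k).card : ℝ) := by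
      simp only [e]
      rw [← Finset.sum_filter, Finset.sum_const, nsmul_eq_mul, mul_one]
      congr 2
      ext m
      simp only [U, Finset.mem_filter, Finset.mem_sdiff, Finset.mem_biUnion, Finset.mem_univ,
        true_and]
      exact ⟨fun h => ⟨h.2, h.1.2⟩, fun h => ⟨⟨⟨l, h.1⟩, h.2⟩, h.1⟩⟩
    have h2 := Finset.card_sdiff_add_card_inter (A l) (A k)
    simp only [hs, simpleNeighbors, Finset.mem_filter, Finset.mem_univ, true_and] at hl
    rw [hl] at h2
    have h3 : (A l \ A k).card + 1 ≤ L := h2 ▸ hx.card_le l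
    rw [h1]
    have : ((A l \ A k).card : ℝ) + 1 ≤ L := by exact_mod_cast h3
    linarith
  have hE := Finset.sum_le_sum fun m (_ : m ∈ U) => hC m
  rw [← Finset.mul_sum] at hE
  have h7 : 0 ≤ 1 - 1 / (L : ℝ) := by
    rw [sub_nonneg, div_le_one hL0]; exact_mod_cast hL
  have hF := mul_le_mul_of_nonneg_left hD h7
  have hG : (1 - 1 / (L : ℝ)) * ((L - 1) * ∑ l ∈ s, (x l : ℝ)) =
      ((L : ℝ) - 1) ^ 2 / L * ∑ l ∈ s, (x l : ℝ) := by
    field_simp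
  linarith

/-- The extreme case is `R = R₁ = L`, where the pair bound equals `L - 1`. If `R₁` falls short of
`L`, the gain in the linear term, at least `C / 2` per unit, outweighs the lost pairs. -/
theorem mass_bound {L C D R R₁ Q : ℝ} (hL : 2 ≤ L) (hC : 0 ≤ C) (hD : 3 * D ^ 2 ≤ C)
    (hR : 2 * R ≤ L + R₁) (hR₁ : R₁ ≤ R) (hQ : R₁ ^ 2 - R₁ - (L - 1) ^ 2 / L * R₁ ≤ Q) :
    1 - L * C + (L - 1) / L * D ^ 2 ≤ 1 - C * R + D ^ 2 / L * Q := by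
  have hL0 : 0 < L := by linarith
  have hT : 0 ≤ L - R₁ := by linarith
  have h1 : L - 1 - (L + 1) * (L - R₁) ≤ Q := by
    refine le_trans ?_ hQ
    have : R₁ ^ 2 - R₁ - (L - 1) ^ 2 / L * R₁ - (L - 1 - (L + 1) * (L - R₁)) =
      (L - R₁) ^ 2 + (L - R₁) / L := by
      field_simp
      ring
    have h2 : 0 ≤ (L - R₁) / L := div_nonneg hT hL0.le
    nlinarith [sq_nonneg (L - R₁)]
  have h2 : D ^ 2 / L * (L - 1 - Q) ≤ D ^ 2 / L * ((L + 1) * (L - R₁)) :=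
    mul_le_mul_of_nonneg_left (by linarith) (div_nonneg (sq_nonneg _) hL0.le)
  -- The constant `3` comes from `2 * (L + 1) ≤ 3 * L`, valid for `L ≥ 2`.
  have h3 : D ^ 2 / L * ((L + 1) * (L - R₁)) ≤ C / 2 * (L - R₁) := by
    rw [← mul_assoc]
    refine mul_le_mul_of_nonneg_right ?_ hT
    rw [div_mul_eq_mul_div, div_le_iff₀ hL0]
    nlinarith [sq_nonneg D]
  have h4 : C / 2 * (L - R₁) ≤ C * (L - R) := by nlinarith
  have h5 : (L - 1) / L * D ^ 2 = D ^ 2 / L * (L - 1) := by ring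
  linarith

end Combinatorics

/-! ### Lower bound on availability and induction over the phases -/

section Main

variable {M N : Type*} [Fintype N] [DecidableEq M] {A : N → Finset M} {x : N → I} {c : I → I}
  {K : ℕ} {F : ℕ → N → ℝ} {L : ℕ}

/-- The event that `l` is accepted before time `t`. -/
def acceptedBefore (A : N → Finset M) (c : I → I) (K : ℕ) (F : ℕ → N → ℝ) (t : I) (l : N) :
    Set (Outcome N) :=
  {ω | Accepts A (arrival ω) (Survives c K F ω) l ∧ arrival ω l ∈ Set.Iio t}

omit [DecidableEq M] in
theorem measurableSet_acceptedBefore (hc : Measurable c) (t : I) (l : N) :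
    MeasurableSet (acceptedBefore A c K F t l) :=
  (measurableSet_accepted A K F hc l).inter (measurable_arrival l measurableSet_Iio)

/-- With `B` the set of accepted neighbors, the left side is at most `1 - |B| + |B| (|B| - 1) / L`.
This is `1` for empty `B`, and at most `0` for `1 ≤ |B| ≤ L`. -/
theorem indicator_free_ge (hL : 1 ≤ L) (hx : IsInput L A x) (k : N) (t : I) {ω : Outcome N}
    (hω : Function.Injective (arrival ω)) :
    1 - ∑ l ∈ neighbors A k, (acceptedBefore A c K F t l).indicator 1 ω
      + 1 / (L : ℝ) * ∑ l ∈ simpleNeighbors A k, ∑ l' ∈ simpleNeighbors A k,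
        (if Disjoint (A l) (A l') then (acceptedBefore A c K F t l ∩
          acceptedBefore A c K F t l').indicator 1 ω else 0) ≤
      {ω | Free A c K F ω k t}.indicator (1 : Outcome N → ℝ) ω := by
  classical
  have hL0 : (0 : ℝ) < L := by exact_mod_cast hL
  let B : Finset N := {l ∈ neighbors A k | ω ∈ acceptedBefore A c K F t l}
  have hne : ∀ l ∈ neighbors A k, ∃ i, i ∈ A l ∩ A k := fun l hl => by
    simp only [neighbors, Finset.mem_filter, Finset.mem_univ, true_and] at hl
    exact Finset.card_pos.1 hl
  have hB : ∑ l ∈ neighbors A k, (acceptedBefore A c K F t l).indicator (1 : Outcome N → ℝ) ω =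
      B.card := by
    simp only [B, Set.indicator_apply, Pi.one_apply]
    rw [← Finset.sum_filter, Finset.sum_const, nsmul_eq_mul, mul_one]
  have hP : ∑ l ∈ simpleNeighbors A k, ∑ l' ∈ simpleNeighbors A k,
        (if Disjoint (A l) (A l') then (acceptedBefore A c K F t l ∩
          acceptedBefore A c K F t l').indicator (1 : Outcome N → ℝ) ω else 0) ≤
      (B.card : ℝ) * B.card - B.card := by
    have h1 : ((B.offDiag.card : ℕ) : ℝ) = (B.card : ℝ) * B.card - B.card := by
      rw [Finset.offDiag_card, Nat.cast_sub (Nat.le_mul_self _)]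
      push_cast
      ring
    rw [← h1, ← Finset.sum_product', Finset.card_eq_sum_ones, Nat.cast_sum]
    simp only [Nat.cast_one]
    have h2 : ∀ p : N × N, (if Disjoint (A p.1) (A p.2) then (acceptedBefore A c K F t p.1 ∩
          acceptedBefore A c K F t p.2).indicator (1 : Outcome N → ℝ) ω else 0) =
        if Disjoint (A p.1) (A p.2) ∧ ω ∈ acceptedBefore A c K F t p.1 ∩
          acceptedBefore A c K F t p.2 then 1 else 0 := by
      intro p
      rw [ite_and, Set.indicator_apply]
      rfl
    simp only [h2]
    rw [← Finset.sum_filter]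
    refine Finset.sum_le_sum_of_subset_of_nonneg ?_ fun _ _ _ => zero_le_one
    rintro ⟨l, l'⟩ hp
    simp only [Finset.mem_filter, Finset.mem_product] at hp
    obtain ⟨⟨h3, h4⟩, h5, h6, h7⟩ := hp
    simp only [Finset.mem_offDiag, B, Finset.mem_filter]
    refine ⟨⟨simpleNeighbors_subset k h3, h6⟩, ⟨simpleNeighbors_subset k h4, h7⟩, ?_⟩
    rintro rfl
    have := Finset.disjoint_self_iff_empty _ |>.1 h5
    have h8 := hx.one_le_card l
    rw [this] at h8
    simp at h8
  -- Choosing for each accepted neighbor an item shared with `k` is injective, because accepted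
  -- products are disjoint when arrival times are distinct.
  have hcard : (B.card : ℝ) ≤ L := by
    have : B.card ≤ (A k).card := by
      have hex : ∀ l, ∃ i, l ∈ B → i ∈ A l ∩ A k := fun l => by
        by_cases hl : l ∈ B
        · obtain ⟨i, hi⟩ := hne l (Finset.mem_filter.1 hl).1
          exact ⟨i, fun _ => hi⟩
        · obtain ⟨i, _⟩ := Finset.card_pos.1 (hx.one_le_card k)
          exact ⟨i, fun h => absurd h hl⟩
      choose f hf using hex
      refine Finset.card_le_card_of_injOn f (fun l hl => (Finset.mem_inter.1 (hf l hl)).2) ?_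
      intro l hl l' hl' hff
      by_contra hll
      have hd := disjoint_of_accepts hω hll (Finset.mem_filter.1 hl).2.1
        (Finset.mem_filter.1 hl').2.1
      exact Finset.disjoint_left.1 hd (Finset.mem_inter.1 (hf l hl)).1
        (hff ▸ (Finset.mem_inter.1 (hf l' hl')).1)
    exact_mod_cast this.trans (hx.card_le k)
  rw [hB]
  have hP' := mul_le_mul_of_nonneg_left hP (one_div_pos.2 hL0).le
  by_cases hfree : Free A c K F ω k t
  · rw [Set.indicator_of_mem (by exact hfree), Pi.one_apply]
    have hB0 : B = ∅ := by
      rw [Finset.eq_empty_iff_forall_notMem]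
      intro l hl
      obtain ⟨i, hi⟩ := hne l (Finset.mem_filter.1 hl).1
      obtain ⟨ha, ht⟩ := (Finset.mem_filter.1 hl).2
      exact hfree i (Finset.mem_inter.1 hi).2 l ht ha (Finset.mem_inter.1 hi).1
    rw [hB0] at hP' ⊢
    simp only [Finset.card_empty, Nat.cast_zero, mul_zero, sub_zero] at hP' ⊢
    linarith
  · rw [Set.indicator_of_notMem (by exact hfree)]
    have hB1 : (1 : ℝ) ≤ B.card := by
      simp only [Free, Available] at hfree
      push Not at hfree
      obtain ⟨i, hi, l, hl, ha, hil⟩ := hfree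
      have hlB : l ∈ B := by
        simp only [B, Finset.mem_filter, neighbors, Finset.mem_univ, true_and]
        exact ⟨Finset.card_pos.2 ⟨i, Finset.mem_inter.2 ⟨hil, hi⟩⟩, ha, hl⟩
      exact_mod_cast Finset.card_pos.2 ⟨l, hlB⟩
    have h3 : 1 / (L : ℝ) * ((B.card : ℝ) * B.card - B.card) ≤ B.card - 1 := by
      rw [one_div, inv_mul_le_iff₀ hL0]
      nlinarith
    linarith

theorem law_real_free_ge (hc : Measurable c) (hL : 1 ≤ L) (hx : IsInput L A x) (k : N) (t : I) :
    1 - ∑ l ∈ neighbors A k, (law x).real (acceptedBefore A c K F t l)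
      + 1 / (L : ℝ) * ∑ l ∈ simpleNeighbors A k, ∑ l' ∈ simpleNeighbors A k,
        (if Disjoint (A l) (A l') then (law x).real (acceptedBefore A c K F t l ∩
          acceptedBefore A c K F t l') else 0) ≤
      (law x).real {ω | Free A c K F ω k t} := by
  classical
  have hm := measurableSet_acceptedBefore (A := A) (K := K) (F := F) hc t
  have hi {S : Set (Outcome N)} (hS : MeasurableSet S) :
      Integrable (S.indicator (1 : Outcome N → ℝ)) (law x) :=
    (integrable_const (1 : ℝ)).indicator hS
  have hi2 (l l' : N) : Integrable (fun ω => if Disjoint (A l) (A l') then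
      (acceptedBefore A c K F t l ∩ acceptedBefore A c K F t l').indicator (1 : Outcome N → ℝ) ω
        else 0) (law x) := by
    split_ifs
    · exact hi ((hm l).inter (hm l'))
    · exact integrable_zero _ _ _
  have hi3 : Integrable (fun ω => ∑ l ∈ neighbors A k,
      (acceptedBefore A c K F t l).indicator (1 : Outcome N → ℝ) ω) (law x) :=
    integrable_finsetSum _ fun l _ => hi (hm l)
  have hi5 (l : N) : Integrable (fun ω => ∑ l' ∈ simpleNeighbors A k,
        (if Disjoint (A l) (A l') then (acceptedBefore A c K F t l ∩
          acceptedBefore A c K F t l').indicator (1 : Outcome N → ℝ) ω else 0)) (law x) :=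
    integrable_finsetSum _ fun l' _ => hi2 l l'
  have hi4 : Integrable (fun ω => ∑ l ∈ simpleNeighbors A k, ∑ l' ∈ simpleNeighbors A k,
        (if Disjoint (A l) (A l') then (acceptedBefore A c K F t l ∩
          acceptedBefore A c K F t l').indicator (1 : Outcome N → ℝ) ω else 0)) (law x) :=
    integrable_finsetSum _ fun l _ => hi5 l
  have hf := measurableSet_free A K F hc k t
  have key := integral_mono_ae (((integrable_const (1 : ℝ)).sub hi3).add (hi4.const_mul (1 / (L : ℝ))))
    (hi hf) (by
      filter_upwards [ae_arrival_injective x] with ω hω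
      exact indicator_free_ge hL hx k t hω)
  rw [integral_indicator_one hf] at key
  refine le_of_eq_of_le ?_ key
  rw [integral_add' ((integrable_const (1 : ℝ)).sub hi3) (hi4.const_mul _),
    integral_sub' (integrable_const (1 : ℝ)) hi3, integral_const_mul,
    integral_finsetSum _ (fun l _ => hi (hm l)), integral_finsetSum _ (fun l _ => hi5 l)]
  congr 2
  · simp
  · exact Finset.sum_congr rfl fun l _ => (integral_indicator_one (hm l)).symm
  · refine Finset.sum_congr rfl fun l _ => ?_
    rw [integral_finsetSum _ fun l' _ => hi2 l l']
    refine Finset.sum_congr rfl fun l' _ => ?_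
    split_ifs
    · rw [integral_indicator_one ((hm l).inter (hm l'))]
    · simp

theorem integral_one_sub_sq : ∫ z : I, (1 - (z : ℝ)) ^ 2 = 1 / 3 := by
  have h := unitInterval.measurePreserving_coe.integral_comp unitInterval.measurableEmbedding_coe
    (fun z : ℝ => (1 - z) ^ 2)
  rw [h, integral_Icc_eq_integral_Ioc, ← intervalIntegral.integral_of_le zero_le_one,
    intervalIntegral.integral_comp_sub_left (fun z => z ^ 2), integral_pow]
  norm_num

theorem integrable_of_mem_Icc {α : Type*} [MeasurableSpace α] {μ : Measure α} [IsFiniteMeasure μ]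
    {f : α → ℝ} (hf : Measurable f) (h0 : ∀ a, 0 ≤ f a) (h1 : ∀ a, f a ≤ 1) : Integrable f μ :=
  Integrable.of_bound hf.aestronglyMeasurable 1 (ae_of_all _ fun a => by
    rw [Real.norm_eq_abs, abs_of_nonneg (h0 a)]; exact h1 a)

/-- If the run up to time `t` accepts every product at a rate of at most `c`, and draws bits that
are `1` with probability at least `c`, then all items of `k` are available at time `t` with
probability at least `c t`. -/
theorem le_law_real_free (hL : 2 ≤ L) (hc : IsSelectionFunction L c) (hx : IsInput L A x)
    {t : I}
    (hF : ∀ k, ∀ z < t, (c z : ℝ) ≤ bitProb c K F k z)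
    (hrate : ∀ l, (law x).real (acceptedBefore A c K F t l) ≤ x l * ∫ z in Set.Iio t, (c z : ℝ))
    (k : N) : (c t : ℝ) ≤ (law x).real {ω | Free A c K F ω k t} := by
  have hcm : Measurable c := hc.antitone.measurable
  have hcm' : Measurable fun z => (c z : ℝ) := measurable_subtype_coe.comp hcm
  have hL1 : 1 ≤ L := by omega
  have hL0 : (0 : ℝ) < L := by exact_mod_cast hL1
  set C := ∫ z in Set.Iio t, (c z : ℝ) with hCdef
  set D := ∫ z in Set.Iio t, (c z : ℝ) * (1 - (z : ℝ)) ^ L with hDdef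
  have hsel := hc.le_rhs t
  rw [← setIntegral_congr_set (Iio_ae_eq_Iic (a := t)),
    ← setIntegral_congr_set (Iio_ae_eq_Iic (a := t))] at hsel
  have hz0 (z : I) : 0 ≤ 1 - (z : ℝ) := sub_nonneg.2 z.2.2
  have hz1 (z : I) : 1 - (z : ℝ) ≤ 1 := sub_le_self _ z.2.1
  have hcz0 (z : I) : 0 ≤ (c z : ℝ) * (1 - (z : ℝ)) ^ L :=
    mul_nonneg (c z).2.1 (pow_nonneg (hz0 z) _)
  have hcz1 (z : I) : (c z : ℝ) * (1 - (z : ℝ)) ^ L ≤ c z :=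
    mul_le_of_le_one_right (c z).2.1 (pow_le_one₀ (hz0 z) (hz1 z))
  have hm1 : Measurable fun z : I => (c z : ℝ) * (1 - (z : ℝ)) ^ L :=
    hcm'.mul ((measurable_const.sub measurable_subtype_coe).pow_const L)
  have hC0 : 0 ≤ C := integral_nonneg fun z => (c z).2.1
  have hD0 : 0 ≤ D := integral_nonneg hcz0
  have hDi (μ : Measure I) [IsFiniteMeasure μ] :
      Integrable (fun z : I => (c z : ℝ) * (1 - (z : ℝ)) ^ L) μ :=
    integrable_of_mem_Icc hm1 hcz0 fun z => (hcz1 z).trans (c z).2.2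
  have hDC : D ≤ C := integral_mono (hDi _)
    (integrable_of_mem_Icc hcm' (fun z => (c z).2.1) fun z => (c z).2.2) hcz1
  -- Since `c ≤ 1` and `L ≥ 2`, `D` is at most the integral of `(1 - z) ^ 2`. Together with `D ≤ C`
  -- this gives the condition `3 * D ^ 2 ≤ C` of `mass_bound`.
  have hD3 : D ≤ 1 / 3 := by
    refine (setIntegral_le_integral (hDi _) (ae_of_all _ hcz0)).trans ?_
    rw [← integral_one_sub_sq]
    refine integral_mono (hDi _) (integrable_of_mem_Icc
      ((measurable_const.sub measurable_subtype_coe).pow_const 2)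
      (fun z => pow_nonneg (hz0 z) _) fun z => pow_le_one₀ (hz0 z) (hz1 z)) fun z => ?_
    exact (mul_le_of_le_one_left (pow_nonneg (hz0 z) _) (c z).2.2).trans
      (pow_le_pow_of_le_one (hz0 z) (hz1 z) hL)
  have h1 := law_real_free_ge (K := K) (F := F) hcm hL1 hx k t
  have h2 : ∑ l ∈ neighbors A k, (law x).real (acceptedBefore A c K F t l) ≤
      C * ∑ l ∈ neighbors A k, (x l : ℝ) := by
    rw [Finset.mul_sum]
    exact Finset.sum_le_sum fun l _ => (hrate l).trans_eq (mul_comm _ _)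
  have h3 : D ^ 2 * ∑ l ∈ simpleNeighbors A k, ∑ l' ∈ simpleNeighbors A k,
        (if Disjoint (A l) (A l') then (x l : ℝ) * x l' else 0) ≤
      ∑ l ∈ simpleNeighbors A k, ∑ l' ∈ simpleNeighbors A k,
        (if Disjoint (A l) (A l') then (law x).real (acceptedBefore A c K F t l ∩
          acceptedBefore A c K F t l') else 0) := by
    rw [Finset.mul_sum]
    refine Finset.sum_le_sum fun l _ => ?_
    rw [Finset.mul_sum]
    refine Finset.sum_le_sum fun l' _ => ?_
    split_ifs with hd
    · have hne : l ≠ l' := by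
        rintro rfl
        have := Finset.disjoint_self_iff_empty _ |>.1 hd
        have h8 := hx.one_le_card l
        rw [this] at h8
        simp at h8
      rw [mul_comm]
      exact law_real_accepts_pair_ge hcm hx hF hne hd
    · simp
  have h4 := mass_bound (L := L) (C := C) (D := D) (by exact_mod_cast hL) hC0
    (by nlinarith) (two_mul_sum_neighbors_le hx k)
    (Finset.sum_le_sum_of_subset_of_nonneg (simpleNeighbors_subset k) fun l _ _ => (x l).2.1)
    (sum_disjoint_pairs_ge hL1 hx k)
  have h5 := mul_le_mul_of_nonneg_left h3 (one_div_pos.2 hL0).le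
  rw [← mul_assoc, one_div_mul_eq_div] at h5
  linarith

omit [DecidableEq M] in
theorem feasProb_nonneg (q : ℕ) (k : N) : 0 ≤ feasProb A x c K q k := by
  cases q with
  | zero => rw [feasProb]; exact zero_le_one
  | succ q => rw [feasProb]; exact measureReal_nonneg

omit [DecidableEq M] in
/-- The rate at which `k` is accepted at time `z`, relative to `x k`, is at most `c z` once the
number of the phase is at least `c z`. -/
theorem bitProb_mul_freeProb_le [DecidableEq N] (hc : Measurable c) (hK : 0 < K) {k : N} {z : I}
    (hz : 0 < (c z : ℝ)) (h : (c z : ℝ) ≤ feasProb A x c K (phase K z) k) :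
    bitProb c K (feasProb A x c K) k z * freeProb A x c K (feasProb A x c K) k z ≤ c z := by
  have hpos := hz.trans_le h
  have h1 : freeProb A x c K (feasProb A x c K) k z ≤ feasProb A x c K (phase K z) k := by
    rw [feasProb_eq_freeProb A x K hc (phase_lt z hK)]
    exact freeProb_antitone A x K _ k (phase_div_le z hK)
  calc _ ≤ (c z : ℝ) / feasProb A x c K (phase K z) k * feasProb A x c K (phase K z) k :=
        mul_le_mul (min_le_left _ _) h1 (freeProb_nonneg ..) (div_nonneg hz.le hpos.le)
    _ = c z := div_mul_cancel₀ _ hpos.ne'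

/-- In every phase, the computed numbers are at least the selection function. -/
theorem le_feasProb (hL : 2 ≤ L) (hc : IsSelectionFunction L c) (hx : IsInput L A x) {q : ℕ}
    (hq : q < K) {y : I} (hy : (q : ℝ) / K ≤ y) (k : N) : (c y : ℝ) ≤ feasProb A x c K q k := by
  classical
  have hcm : Measurable c := hc.antitone.measurable
  have hcpos (z : I) : 0 < (c z : ℝ) := hc.one_pos.trans_le (hc.antitone z.2.2)
  have hK : 0 < K := by omega
  have hK' : (0 : ℝ) < K := by exact_mod_cast hK
  induction q using Nat.strong_induction_on generalizing y k with
  | _ q ih =>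
  have ht1 : (q : ℝ) / K ≤ 1 := (div_le_one hK').2 (by exact_mod_cast hq.le)
  let t : I := ⟨(q : ℝ) / K, by positivity, ht1⟩
  -- Times before `q / K` belong to earlier phases, so the induction hypothesis applies; there are
  -- none when `q = 0`.
  have hge : ∀ k, ∀ z < t, (c z : ℝ) ≤ feasProb A x c K (phase K z) k := by
    intro k z hz
    have hz' : (z : ℝ) < q / K := hz
    have hq0 : 0 < q := by
      rcases Nat.eq_zero_or_pos q with h | h
      · rw [h, Nat.cast_zero, zero_div] at hz'
        exact absurd z.2.1 (not_le.2 hz')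
      · exact h
    obtain ⟨r, rfl⟩ := Nat.exists_eq_add_of_lt hq0
    rw [zero_add] at hz' hq ih
    have hph := phase_le hK hz'
    exact ih _ (by omega) (by omega) (phase_div_le z hK) k
  have hty : (c y : ℝ) ≤ c t := hc.antitone (show t ≤ y from hy)
  refine hty.trans ?_
  rw [feasProb_eq_freeProb A x K hcm hq]
  refine le_trans ?_ (law_real_free_le_freeProb A x K _ (Finset.card_pos.1 (hx.one_le_card k)) _)
  refine le_law_real_free hL hc hx (t := t) ?_ ?_ k
  · intro k z hz
    have h1 := hge k z hz
    have h2 : feasProb A x c K (phase K z) k ≤ 1 := by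
      rw [feasProb_eq_freeProb A x K hcm (phase_lt z hK)]
      exact freeProb_le_one ..
    refine le_min ?_ (c z).2.2
    rw [le_div_iff₀ ((hcpos z).trans_le h1)]
    exact mul_le_of_le_one_right (hcpos z).le h2
  · intro l
    refine (law_real_accepts A x K _ hcm feasProb_nonneg l measurableSet_Iio).trans_le ?_
    refine mul_le_mul_of_nonneg_left ?_ (x l).2.1
    have hb0 (z : I) : 0 ≤ bitProb c K (feasProb A x c K) l z :=
      le_min (div_nonneg (c z).2.1 (feasProb_nonneg _ _)) zero_le_one
    refine setIntegral_mono_on (integrable_of_mem_Icc ?_ ?_ ?_)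
      (integrable_of_mem_Icc (measurable_subtype_coe.comp hcm) (fun z => (c z).2.1)
        fun z => (c z).2.2) measurableSet_Iio fun z hz =>
      bitProb_mul_freeProb_le hcm hK (hcpos z) (hge l z hz)
    · exact (measurable_bitProb K _ hcm l).mul
        ((freeProb_antitone A x K _ l).measurable.comp measurable_subtype_coe)
    · exact fun z => mul_nonneg (hb0 z) (freeProb_nonneg ..)
    · exact fun z => mul_le_one₀ (min_le_right _ _) (freeProb_nonneg ..) (freeProb_le_one ..)

end Main

end RCRS

/-! ### The selectability guarantee -/

theorem mainTheorem7 (L : ℕ) (hL : 2 ≤ L) (c : I → I) (hc : RCRS.IsSelectionFunction L c)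
    (K : ℕ) (hK : 2 * (L : ℝ) / (c 1 : ℝ) ≤ K)
    {M N : Type*} [DecidableEq M] [Fintype N] (A : N → Finset M) (x : N → I)
    (hx : RCRS.IsInput L A x) :
    RCRS.IsSelectableOn A x (RCRS.RecursiveRCRS A x c K)
      ((1 - (L : ℝ) / (K * (c 1 : ℝ))) * ∫ y : I, (c y : ℝ)) := by
  classical
  have hcm : Measurable c := hc.antitone.measurable
  have hc1 := hc.one_pos
  have hcpos (z : I) : (c 1 : ℝ) ≤ c z := hc.antitone z.2.2
  have hL0 : (0 : ℝ) < L := by exact_mod_cast (by omega : 0 < L)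
  have hK' : (0 : ℝ) < K := lt_of_lt_of_le (by positivity) hK
  have hK0 : 0 < K := by exact_mod_cast hK'
  refine ⟨ae_of_all _ fun ω j h => ((RCRS.accepts_iff _ _ _ _).1 h).1.1, ?_,
    RCRS.measurableSet_accepted A K _ hcm, fun k => ?_⟩
  · filter_upwards [RCRS.ae_arrival_injective x] with ω hω j j' hj h h'
    exact RCRS.disjoint_of_accepts hω hj h h'
  · have h := RCRS.law_real_accepts A x K _ hcm
      (RCRS.feasProb_nonneg (A := A) (x := x) (c := c) (K := K)) k MeasurableSet.univ
    simp only [Set.mem_univ, and_true, setIntegral_univ] at h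
    refine le_of_le_of_eq ?_ h.symm
    rw [mul_comm _ (x k : ℝ)]
    refine mul_le_mul_of_nonneg_left ?_ (x k).2.1
    rw [← integral_const_mul]
    have hb0 (z : I) : 0 ≤ RCRS.bitProb c K (RCRS.feasProb A x c K) k z :=
      le_min (div_nonneg (c z).2.1 (RCRS.feasProb_nonneg _ _)) zero_le_one
    refine integral_mono ((RCRS.integrable_of_mem_Icc (measurable_subtype_coe.comp hcm)
      (fun z => (c z).2.1) fun z => (c z).2.2).const_mul _)
      (RCRS.integrable_of_mem_Icc ?_ ?_ ?_) fun z => ?_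
    · exact (RCRS.measurable_bitProb K _ hcm k).mul
        ((RCRS.freeProb_antitone A x K _ k).measurable.comp measurable_subtype_coe)
    · exact fun z => mul_nonneg (hb0 z) (RCRS.freeProb_nonneg ..)
    · exact fun z => mul_le_one₀ (min_le_right _ _) (RCRS.freeProb_nonneg ..)
        (RCRS.freeProb_le_one ..)
    · have hlt := RCRS.phase_lt z hK0
      have hge := RCRS.le_feasProb hL hc hx hlt (RCRS.phase_div_le z hK0) k
      have heq := RCRS.feasProb_eq_freeProb A x K hcm hlt k
      have hr1 : (RCRS.phase K z : ℝ) / K ≤ 1 := (RCRS.phase_div_le z hK0).trans z.2.2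
      have hsub := RCRS.freeProb_sub_le A x K (RCRS.feasProb A x c K) (c := c) hx k
        (y := ⟨(RCRS.phase K z : ℝ) / K, by positivity, hr1⟩) (z := z)
        (RCRS.phase_div_le z hK0)
      rw [← heq] at hsub
      have hd := mul_le_mul_of_nonneg_left (RCRS.sub_phase_div_le z hK0) hL0.le
      set f := RCRS.feasProb A x c K (RCRS.phase K z) k with hf
      have hcf : (c 1 : ℝ) ≤ f := (hcpos z).trans hge
      have hf0 : 0 < f := hc1.trans_le hcf
      have hbit : RCRS.bitProb c K (RCRS.feasProb A x c K) k z = (c z : ℝ) / f :=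
        min_eq_left ((div_le_one hf0).2 hge)
      -- The additive loss `L / K` since the start of the phase becomes a relative loss because `f ≥
      -- c 1`.
      have hfree : f * (1 - (L : ℝ) / (K * (c 1 : ℝ))) ≤
          RCRS.freeProb A x c K (RCRS.feasProb A x c K) k z := by
        have : (L : ℝ) * (1 / K) ≤ f * ((L : ℝ) / (K * (c 1 : ℝ))) := by
          rw [mul_one_div, mul_div_assoc', div_le_div_iff₀ hK' (by positivity)]
          have := mul_le_mul_of_nonneg_left hcf (mul_pos hL0 hK').le
          linarith
        linarith
      simp only [hbit]
      calc (1 - (L : ℝ) / (K * (c 1 : ℝ))) * (c z : ℝ) =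
            (c z : ℝ) / f * (f * (1 - (L : ℝ) / (K * (c 1 : ℝ)))) := by
            field_simp
        _ ≤ _ := mul_le_mul_of_nonneg_left hfree (div_nonneg (c z).2.1 hf0.le)
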